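/- Let $Y=(Y(t))_{t\ge 0}$ be a real-valued Lévy process with $Y(0)=0$ on a probability space $(\Omega,\mathcal F,\mathbb P)$ (independent and stationary increments, almost surely càdlàg paths), and let $(W_n)_{n\ge 0}$ be i.i.d. strictly positive random variables, independent of $Y$. Put $T_0=0$, $T_n=W_0+\dots+W_{n-1}$ and $S_n=Y(T_n)$, and fix $q>0$. Let $N=\inf\{n\ge 1: S_n>0\}$ and $\hat N=\inf\{n\ge 1: S_n\le 0\}$ (with $\inf\emptyset=\infty$), and for $\theta\in\mathbb R$ let $$\kappa(q,\theta)=\mathbb E\big[e^{-qT_1+i\theta S_1}\big],\quad \varphi(q,\theta)=\mathbb E\big[e^{-qT_N+i\theta S_N}1_{\{N<\infty\}}\big],\quad \hat\varphi(q,\theta)=\mathbb E\big[e^{-qT_{\hat N}+i\theta S_{\hat N}}1_{\{\hat N<\infty\}}\big].$$ Define the measure $$\mu(A)=\frac{\mathbb E\big[\sum_{k=0}^{\hat N-1}e^{-qT_k}1_A(S_k)\big]}{\mathbb E\big[\sum_{k=0}^{\hat N-1}e^{-qT_k}\big]}.$$ Then: 1. $\mu$ is a probability measure concentrated on $[0,\infty)$,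 and for every measurable $\mu$-integrable $f:\mathbb R\to\mathbb R$, $$\int_{[0,\infty)}f(y)\,\mu(dy)=\frac{\mathbb E\big[\sum_{k=0}^{\hat N-1}e^{-qT_k}f(S_k)\big]}{\mathbb E\big[\sum_{k=0}^{\hat N-1}e^{-qT_k}\big]}.$$ 2. Let $R:\mathbb R\to\mathbb R$ be strictly increasing, and let $x\in\mathbb R$ be such that $\mathbb E\big[\sum_{s\ge 0}|R(x+S_s)|\int_{T_s}^{T_{s+1}}e^{-qr}\,dr\big]<\infty$. Then $y\mapsto R(x+y)$ is $\mu$-integrable on $[0,\infty)$, and the Gittins index $$\Gamma(x)=\sup_{\tau>0}\frac{\mathbb E\big[\sum_{k=0}^{\tau-1}e^{-qT_k}R(x+S_k)\big]}{\mathbb E\big[\sum_{k=0}^{\tau-1}e^{-qT_k}\big]},$$ where the supremum is over all $(\mathbb N\cup\{\infty\})$-valued stopping times $\tau$ of the filtration whose $n$-th member is the $\mathbb P$-completion of $\sigma(S_0,\dots,S_n,W_0,\dots,W_{n-1})$, satisfies $$\Gamma(x)=\int_{[0,\infty)}R(x+y)\,\mu(dy).$$ 3. For every $\theta\in\mathbb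 R$ the numbers $1-\kappa(q,\theta)$, $1-\hat\varphi(q,0)$ and $1-\varphi(q,\theta)$ are nonzero, and $$\int_{[0,\infty)}e^{i\theta y}\,\mu(dy)=\frac{1-\hat\varphi(q,\theta)}{1-\kappa(q,\theta)}\cdot\frac{1-\kappa(q,0)}{1-\hat\varphi(q,0)}=\frac{1-\varphi(q,0)}{1-\varphi(q,\theta)}.$$ -/

import Mathlib

open MeasureTheory ProbabilityTheory Filter Topology Set
open scoped NNReal ENNReal

noncomputable section

namespace LevyBandit

variable {Ω : Type*} [MeasurableSpace Ω]

/-- `Y` is a one-dimensional Lévy process under `P`: it starts at `0`, has independent and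
stationary increments, and almost all of its paths are right-continuous with left limits. -/
structure IsLevyProcess (Y : ℝ≥0 → Ω → ℝ) (P : Measure Ω) : Prop where
  measurable : ∀ t, Measurable (Y t)
  start_zero : ∀ᵐ ω ∂P, Y 0 ω = 0
  indep_increments : HasIndepIncrements Y P
  stationary_increments : ∀ s t : ℝ≥0,
    IdentDistrib (fun ω => Y (s + t) ω - Y s ω) (fun ω => Y t ω - Y 0 ω) P P
  cadlag : ∀ᵐ ω ∂P, ∀ t : ℝ≥0,
    ContinuousWithinAt (fun s => Y s ω) (Ici t) t ∧
      ∃ l : ℝ, Tendsto (fun s => Y s ω) (𝓝[<] t) (𝓝 l)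

/-- `W` is a sequence of inter-arrival times of a renewal process: i.i.d. and strictly positive. -/
structure IsRenewalSequence (W : ℕ → Ω → ℝ≥0) (P : Measure Ω) : Prop where
  measurable : ∀ n, Measurable (W n)
  pos : ∀ n, ∀ᵐ ω ∂P, 0 < W n ω
  indep : iIndepFun W P
  identDistrib : ∀ n, IdentDistrib (W n) (W 0) P P

/-- An arm driven by a Lévy process `Y` and by renewal inter-arrival times `W` which are
independent of the whole process `Y`. -/
structure IsLevyArm (Y : ℝ≥0 → Ω → ℝ) (W : ℕ → Ω → ℝ≥0) (P : Measure Ω) : Prop where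
  levy : IsLevyProcess Y P
  renewal : IsRenewalSequence W P
  indep : IndepFun (fun ω t => Y t ω) (fun ω n => W n ω) P

/-- The renewal times `T_n = W_0 + ⋯ + W_{n-1}`. -/
def T (W : ℕ → Ω → ℝ≥0) (n : ℕ) (ω : Ω) : ℝ≥0 := ∑ k ∈ Finset.range n, W k ω

/-- The arm observed at the renewal times, `S_n = Y(T_n)`. -/
def S (Y : ℝ≥0 → Ω → ℝ) (W : ℕ → Ω → ℝ≥0) (n : ℕ) (ω : Ω) : ℝ := Y (T W n ω) ω

/-- The first strict ascending ladder epoch `N = inf {n ≥ 1 : S_n > 0}` (`⊤` if there is none). -/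
def N (Y : ℝ≥0 → Ω → ℝ) (W : ℕ → Ω → ℝ≥0) : Ω → WithTop ℕ := hittingAfter (S Y W) (Ioi 0) 1

/-- The first weak descending ladder epoch `inf {n ≥ 1 : S_n ≤ 0}` (`⊤` if there is none). -/
def Nhat (Y : ℝ≥0 → Ω → ℝ) (W : ℕ → Ω → ℝ≥0) : Ω → WithTop ℕ := hittingAfter (S Y W) (Iic 0) 1

/-- `κ(q, θ) = E[exp(-q T_1 + i θ S_1)]`. -/
def kappa (Y : ℝ≥0 → Ω → ℝ) (W : ℕ → Ω → ℝ≥0) (P : Measure Ω) (q θ : ℝ) : ℂ :=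
  ∫ ω, Complex.exp (-(q : ℂ) * ((T W 1 ω : ℝ) : ℂ) + Complex.I * θ * (S Y W 1 ω : ℂ)) ∂P

/-- `E[exp(-q T_τ + i θ S_τ)]` for a random time `τ`, where the integrand is `0` on `{τ = ∞}`. -/
def stoppedTransform (Y : ℝ≥0 → Ω → ℝ) (W : ℕ → Ω → ℝ≥0) (P : Measure Ω)
    (τ : Ω → WithTop ℕ) (q θ : ℝ) : ℂ :=
  ∫ ω, (match τ ω with
    | ⊤ => 0
    | (n : ℕ) =>
      Complex.exp (-(q : ℂ) * ((T W n ω : ℝ) : ℂ) + Complex.I * θ * (S Y W n ω : ℂ))) ∂P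

/-- `φ(q, θ) = E[exp(-q T_N + i θ S_N)]`. -/
def phi (Y : ℝ≥0 → Ω → ℝ) (W : ℕ → Ω → ℝ≥0) (P : Measure Ω) (q θ : ℝ) : ℂ :=
  stoppedTransform Y W P (N Y W) q θ

/-- The transform of `(T, S)` at the first weak descending ladder epoch. -/
def phihat (Y : ℝ≥0 → Ω → ℝ) (W : ℕ → Ω → ℝ≥0) (P : Measure Ω) (q θ : ℝ) : ℂ :=
  stoppedTransform Y W P (Nhat Y W) q θ

open Classical in
/-- The discounted sum `∑_{k=0}^{τ-1} e^{-q T_k} f(S_k)`. -/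
def discountedSum (Y : ℝ≥0 → Ω → ℝ) (W : ℕ → Ω → ℝ≥0) (q : ℝ) (f : ℝ → ℝ)
    (τ : Ω → WithTop ℕ) (ω : Ω) : ℝ :=
  ∑' k : ℕ, if (k : WithTop ℕ) < τ ω then Real.exp (-q * (T W k ω : ℝ)) * f (S Y W k ω) else 0

/-- `E[∑_{k<τ} e^{-q T_k} f(S_k)] / E[∑_{k<τ} e^{-q T_k}]`. -/
def discountedRatio (Y : ℝ≥0 → Ω → ℝ) (W : ℕ → Ω → ℝ≥0) (P : Measure Ω) (q : ℝ) (f : ℝ → ℝ)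
    (τ : Ω → WithTop ℕ) : ℝ :=
  (∫ ω, discountedSum Y W q f τ ω ∂P) / (∫ ω, discountedSum Y W q (fun _ => 1) τ ω ∂P)

/-- The filtration of the arm: the `n`-th σ-algebra is the `P`-completion of
`σ(Y(T_0), …, Y(T_n), W_0, …, W_{n-1})`.  As the completions may contain null sets outside of the
given σ-algebra of `Ω`, the ambient σ-algebra is taken to be the power set. -/
def armFiltration (Y : ℝ≥0 → Ω → ℝ) (W : ℕ → Ω → ℝ≥0) (P : Measure Ω) :
    @Filtration Ω ℕ _ ⊤ where
  seq n := eventuallyMeasurableSpace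
    ((⨆ i ∈ Finset.range (n + 1), (inferInstance : MeasurableSpace ℝ).comap (S Y W i)) ⊔
      (⨆ i ∈ Finset.range n, (inferInstance : MeasurableSpace ℝ≥0).comap (W i))) (ae P)
  mono' := by
    intro m n hmn s hs
    obtain ⟨t, ht, hst⟩ := hs
    refine ⟨t, ?_, hst⟩
    refine (sup_le_sup (biSup_mono fun i hi => ?_) (biSup_mono fun i hi => ?_) :
      (⨆ i ∈ Finset.range (m + 1), (inferInstance : MeasurableSpace ℝ).comap (S Y W i)) ⊔
        (⨆ i ∈ Finset.range m, (inferInstance : MeasurableSpace ℝ≥0).comap (W i)) ≤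
      (⨆ i ∈ Finset.range (n + 1), (inferInstance : MeasurableSpace ℝ).comap (S Y W i)) ⊔
        (⨆ i ∈ Finset.range n, (inferInstance : MeasurableSpace ℝ≥0).comap (W i))) t ht
    · exact Finset.range_mono (Nat.succ_le_succ hmn) hi
    · exact Finset.range_mono hmn hi
  le' _ := le_top

/-- The Gittins index at `x`: the supremum, over all stopping times `τ > 0`, of
`E_x[∑_{k<τ} e^{-q T_k} R(Y(T_k))] / E_x[∑_{k<τ} e^{-q T_k}]`, where `P_x` is the law under which
the arm starts at `x`, i.e. the driving process is `x + Y`. -/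
def gittinsIndex (Y : ℝ≥0 → Ω → ℝ) (W : ℕ → Ω → ℝ≥0) (P : Measure Ω) (q : ℝ) (R : ℝ → ℝ)
    (x : ℝ) : EReal :=
  ⨆ (τ : Ω → WithTop ℕ) (_ : IsStoppingTime (armFiltration Y W P) τ) (_ : ∀ ω, 0 < τ ω),
    ((discountedRatio Y W P q (fun y => R (x + y)) τ : ℝ) : EReal)

/-- The standing integrability condition under `P_x`:
`E_x[∑_s |R(Y(T_s))| ∫_{T_s}^{T_{s+1}} e^{-q r} dr] < ∞`. -/
def RewardIntegrable (Y : ℝ≥0 → Ω → ℝ) (W : ℕ → Ω → ℝ≥0) (P : Measure Ω) (q : ℝ) (R : ℝ → ℝ)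
    (x : ℝ) : Prop :=
  ∫⁻ ω, ∑' s : ℕ, ENNReal.ofReal (|R (x + S Y W s ω)| *
    ∫ r in (T W s ω : ℝ)..(T W (s + 1) ω : ℝ), Real.exp (-q * r)) ∂P < ∞

/-- The discounted occupation measure `A ↦ E[∑_{k<τ} e^{-q T_k} 1_A(S_k)]`, with `τ` the first
weak descending ladder epoch. -/
def occupation (Y : ℝ≥0 → Ω → ℝ) (W : ℕ → Ω → ℝ≥0) (P : Measure Ω) (q : ℝ) : Measure ℝ :=
  Measure.sum fun k : ℕ =>
    ((P.restrict {ω | (k : WithTop ℕ) < Nhat Y W ω}).withDensity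
      fun ω => ENNReal.ofReal (Real.exp (-q * (T W k ω : ℝ)))).map (S Y W k)

/-- The measure `μ`: the discounted occupation measure divided by its total mass. -/
def mu (Y : ℝ≥0 → Ω → ℝ) (W : ℕ → Ω → ℝ≥0) (P : Measure Ω) (q : ℝ) : Measure ℝ :=
  (occupation Y W P q univ)⁻¹ • occupation Y W P q

end LevyBandit

end

/-! Independence of `Y` and `W` makes the pairs (displacement, duration) over successive renewal
intervals i.i.d. (`IsLevyArm.isIIDSteps`). Everything then reduces to a discounted random walk,
whose one-step discount has mean `d < 1` because durations are positive.

Gittins index. Let `Γ = ∫ R(x + y) μ(dy)`, the reward rate achieved by `Nhat`, and `h(y) = R(x + y)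
- Γ`, so that the expected discounted sum of `h` up to `Nhat` is zero. The claim is that no stopping
rule makes this sum positive. Let `V` be the optimal stopping value for running reward `h`, where
stopping at once pays 0; it is increasing because `h` is. If `V(0) > 0`, then `V > 0` on `[0, ∞)`,
so stopping is never optimal before the first weak descent, and Bellman's equation can be run
untruncated until then. The rewards cancel and at the exit `V ≤ V(0)`, whence `V(0) ≤ d V(0)`, which
is absurd. So `V(0) = 0` (`IsIIDSteps.value_zero`), and since `V` dominates continuation, every rule
earns at most 0 (`IsIIDSteps.tsum_occ_le`). The supremum is attained at `Nhat`.

Fourier transform. Let `U(θ)` be the discounted transform of the walk before `Nhat`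
(`occTransform`); the transform of `μ` is `U(θ) / U(0)`. One further step from before `Nhat` either
stays positive or exits, which gives `1 - φ̂ = (1 - κ) U` (`IsIIDSteps.one_sub_descending`).
Reversing time turns staying positive into being a strict ladder epoch, and the renewal equation for
ladder epochs gives `(1 - φ) U = 1` (`IsIIDSteps.one_sub_ascending_mul`). -/

noncomputable section

namespace LevyBandit

/-! ### Discounted random walk with i.i.d. steps and its Markov property. -/

section

variable {Ω : Type*} [MeasurableSpace Ω]

/-- Position of the walk with steps `(x k).1` after `n` steps. -/
def walk (x : ℕ → ℝ × ℝ≥0) (n : ℕ) : ℝ := ∑ k ∈ Finset.range n, (x k).1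

/-- Time elapsed after `n` steps with durations `(x k).2`. -/
def clock (x : ℕ → ℝ × ℝ≥0) (n : ℕ) : ℝ≥0 := ∑ k ∈ Finset.range n, (x k).2

/-- The discount factor `exp (-q t)` at the time of the `n`-th step. -/
def discount (q : ℝ) (x : ℕ → ℝ × ℝ≥0) (n : ℕ) : ℝ≥0∞ :=
  ENNReal.ofReal (Real.exp (-q * (clock x n : ℝ)))

/-- An i.i.d. sequence of steps (displacement, duration) with positive durations. -/
structure IsIIDSteps (X : ℕ → Ω → ℝ × ℝ≥0) (P : Measure Ω) : Prop where
  measurable : ∀ n, Measurable (X n)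
  indep : iIndepFun X P
  identDistrib : ∀ n, IdentDistrib (X n) (X 0) P P
  pos : ∀ᵐ ω ∂P, 0 < (X 0 ω).2

/-- The σ-algebra generated by the first `n` steps. -/
@[reducible] def past (X : ℕ → Ω → ℝ × ℝ≥0) (n : ℕ) : MeasurableSpace Ω :=
  ⨆ i ∈ Iio n, (inferInstance : MeasurableSpace (ℝ × ℝ≥0)).comap (X i)

/-- The discounted one-step transition operator. -/
def stepOp (X : ℕ → Ω → ℝ × ℝ≥0) (P : Measure Ω) (q : ℝ) (g : ℝ → ℝ≥0∞) (y : ℝ) : ℝ≥0∞ :=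
  ∫⁻ ω, ENNReal.ofReal (Real.exp (-q * ((X 0 ω).2 : ℝ))) * g (y + (X 0 ω).1) ∂P

/-- Discounted expectation of `g` at the `n`-th position on the event `D`. -/
def occ (X : ℕ → Ω → ℝ × ℝ≥0) (P : Measure Ω) (q : ℝ) (D : Set Ω) (n : ℕ) (g : ℝ → ℝ≥0∞) :
    ℝ≥0∞ :=
  ∫⁻ ω in D, discount q (X · ω) n * g (walk (X · ω) n) ∂P

variable {X : ℕ → Ω → ℝ × ℝ≥0} {P : Measure Ω} {q : ℝ}

@[simp] lemma walk_zero (x : ℕ → ℝ × ℝ≥0) : walk x 0 = 0 := by simp [walk]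

@[simp] lemma clock_zero (x : ℕ → ℝ × ℝ≥0) : clock x 0 = 0 := by simp [clock]

@[simp] lemma discount_zero (q : ℝ) (x : ℕ → ℝ × ℝ≥0) : discount q x 0 = 1 := by simp [discount]

lemma walk_succ (x : ℕ → ℝ × ℝ≥0) (n : ℕ) : walk x (n + 1) = walk x n + (x n).1 :=
  Finset.sum_range_succ _ _

lemma clock_succ (x : ℕ → ℝ × ℝ≥0) (n : ℕ) : clock x (n + 1) = clock x n + (x n).2 :=
  Finset.sum_range_succ _ _

lemma discount_succ (q : ℝ) (x : ℕ → ℝ × ℝ≥0) (n : ℕ) :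
    discount q x (n + 1) = discount q x n * ENNReal.ofReal (Real.exp (-q * ((x n).2 : ℝ))) := by
  rw [discount, discount, ← ENNReal.ofReal_mul (Real.exp_nonneg _), ← Real.exp_add, clock_succ]
  push_cast
  ring_nf

lemma measurable_walk (n : ℕ) : Measurable (fun x : ℕ → ℝ × ℝ≥0 => walk x n) := by
  unfold walk; fun_prop

lemma measurable_clock (n : ℕ) : Measurable (fun x : ℕ → ℝ × ℝ≥0 => clock x n) := by
  unfold clock; fun_prop

lemma measurable_discount (q : ℝ) (n : ℕ) :
    Measurable (fun x : ℕ → ℝ × ℝ≥0 => discount q x n) := by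
  have := measurable_clock n
  unfold discount; fun_prop

omit [MeasurableSpace Ω] in
lemma measurable_past_step {i n : ℕ} (h : i < n) : Measurable[past X n] (X i) := by
  have : (inferInstance : MeasurableSpace (ℝ × ℝ≥0)).comap (X i) ≤ past X n :=
    le_biSup (fun i => (inferInstance : MeasurableSpace (ℝ × ℝ≥0)).comap (X i)) (mem_Iio.2 h)
  exact (comap_measurable (X i)).mono this le_rfl

lemma past_le (hX : ∀ n, Measurable (X n)) (n : ℕ) : past X n ≤ ‹MeasurableSpace Ω› :=
  iSup₂_le fun i _ => (hX i).comap_le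

omit [MeasurableSpace Ω] in
lemma measurable_past_walk {m n : ℕ} (h : m ≤ n) :
    Measurable[past X n] (fun ω => walk (X · ω) m) := by
  unfold walk
  refine Finset.measurable_fun_sum _ fun i hi => ?_
  exact measurable_fst.comp (measurable_past_step ((Finset.mem_range.1 hi).trans_le h))

omit [MeasurableSpace Ω] in
lemma measurable_past_clock {m n : ℕ} (h : m ≤ n) :
    Measurable[past X n] (fun ω => clock (X · ω) m) := by
  unfold clock
  refine Finset.measurable_fun_sum _ fun i hi => ?_
  exact measurable_snd.comp (measurable_past_step ((Finset.mem_range.1 hi).trans_le h))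

omit [MeasurableSpace Ω] in
lemma measurable_past_discount {m n : ℕ} (h : m ≤ n) :
    Measurable[past X n] (fun ω => discount q (X · ω) m) := by
  have h1 : Measurable (fun t : ℝ≥0 => ENNReal.ofReal (Real.exp (-q * (t : ℝ)))) := by fun_prop
  exact h1.comp (measurable_past_clock h)

lemma IsIIDSteps.indep_future (hX : IsIIDSteps X P) (n : ℕ) :
    Indep (past X n) (⨆ i ∈ Ici n, (inferInstance : MeasurableSpace (ℝ × ℝ≥0)).comap (X i)) P :=
  indep_iSup_of_disjoint (fun i => (hX.measurable i).comap_le) hX.indep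
    (Set.disjoint_left.2 fun _ h1 h2 => (mem_Ici.1 h2).not_gt (mem_Iio.1 h1))

lemma IsIIDSteps.indep_step (hX : IsIIDSteps X P) (n : ℕ) :
    Indep (past X n) ((inferInstance : MeasurableSpace (ℝ × ℝ≥0)).comap (X n)) P :=
  indep_of_indep_of_le_right (hX.indep_future n)
    (le_biSup (fun i => (inferInstance : MeasurableSpace (ℝ × ℝ≥0)).comap (X i)) (mem_Ici.2 le_rfl))

/-- The pair `(C, Z)` is a function of the first `n` steps, hence independent of step `n`; under the
product law, Tonelli integrates that step out first, with the law of step 0. -/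
lemma IsIIDSteps.lintegral_step [IsProbabilityMeasure P] (hX : IsIIDSteps X P) {n : ℕ}
    {C : Ω → ℝ≥0∞} {Z : Ω → ℝ} (hC : Measurable[past X n] C) (hZ : Measurable[past X n] Z)
    {g : ℝ → ℝ≥0∞} (hg : Measurable g) :
    ∫⁻ ω, C ω * ENNReal.ofReal (Real.exp (-q * ((X n ω).2 : ℝ))) * g (Z ω + (X n ω).1) ∂P =
      ∫⁻ ω, C ω * stepOp X P q g (Z ω) ∂P := by
  have hC' := hC.mono (past_le hX.measurable n) le_rfl
  have hZ' := hZ.mono (past_le hX.measurable n) le_rfl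
  have hXn := hX.measurable n
  have hCZ : Measurable[past X n] (fun ω => (C ω, Z ω)) := hC.prodMk hZ
  have hind : IndepFun (fun ω => (C ω, Z ω)) (X n) P := by
    rw [IndepFun_iff_Indep]
    exact indep_of_indep_of_le_left (hX.indep_step n) hCZ.comap_le
  have hmap := (indepFun_iff_map_prod_eq_prod_map_map (hC'.prodMk hZ').aemeasurable
    hXn.aemeasurable).1 hind
  rw [(hX.identDistrib n).map_eq] at hmap
  have hF : Measurable (fun p : (ℝ≥0∞ × ℝ) × (ℝ × ℝ≥0) =>
      p.1.1 * ENNReal.ofReal (Real.exp (-q * (p.2.2 : ℝ))) * g (p.1.2 + p.2.1)) := by fun_prop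
  calc _ = ∫⁻ p, p.1.1 * ENNReal.ofReal (Real.exp (-q * (p.2.2 : ℝ))) * g (p.1.2 + p.2.1)
        ∂(P.map fun ω => ((C ω, Z ω), X n ω)) :=
        (lintegral_map hF ((hC'.prodMk hZ').prodMk hXn)).symm
    _ = _ := by
      rw [hmap, lintegral_prod _ hF.aemeasurable, lintegral_map hF.lintegral_prod_right'
        (hC'.prodMk hZ')]
      refine lintegral_congr fun ω => ?_
      have h0 := hX.measurable 0
      rw [lintegral_map (by fun_prop) h0, stepOp, ← lintegral_const_mul _ (by fun_prop)]
      simp only [mul_assoc]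

lemma measurable_occ_integrand (hX : ∀ n, Measurable (X n)) (n : ℕ) {g : ℝ → ℝ≥0∞}
    (hg : Measurable g) :
    Measurable (fun ω => discount q (X · ω) n * g (walk (X · ω) n)) :=
  ((measurable_discount q n).comp (measurable_pi_lambda _ hX)).mul
    (hg.comp ((measurable_walk n).comp (measurable_pi_lambda _ hX)))

/-- Markov property in the form used throughout: when the event is decided by time `n`, the last
step can be moved from the walk into the test function. -/
lemma IsIIDSteps.occ_succ [IsProbabilityMeasure P] (hX : IsIIDSteps X P) {n : ℕ} {D : Set Ω}
    (hD : MeasurableSet[past X n] D) {g : ℝ → ℝ≥0∞} (hg : Measurable g) :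
    occ X P q D (n + 1) g = occ X P q D n (stepOp X P q g) := by
  have hD' := past_le hX.measurable n _ hD
  have hC : Measurable[past X n] (D.indicator fun ω => discount q (X · ω) n) :=
    (measurable_past_discount le_rfl).indicator hD
  have := hX.lintegral_step (q := q) hC (measurable_past_walk le_rfl) hg
  rw [occ, occ, ← lintegral_indicator hD', ← lintegral_indicator hD']
  convert this using 2 <;>
  · funext ω
    by_cases h : ω ∈ D <;> simp [h, discount_succ, walk_succ]

lemma stepOp_mono {g g' : ℝ → ℝ≥0∞} (h : g ≤ g') : stepOp X P q g ≤ stepOp X P q g' :=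
  fun _ => lintegral_mono fun _ => by gcongr; exact h _

lemma monotone_stepOp {g : ℝ → ℝ≥0∞} (h : Monotone g) : Monotone (stepOp X P q g) :=
  fun _ _ hy => lintegral_mono fun _ => by gcongr; exact h (by gcongr)

/-- The discount over one step. -/
def stepDiscount (X : ℕ → Ω → ℝ × ℝ≥0) (P : Measure Ω) (q : ℝ) : ℝ≥0∞ :=
  ∫⁻ ω, ENNReal.ofReal (Real.exp (-q * ((X 0 ω).2 : ℝ))) ∂P

lemma stepOp_const (hX : Measurable (X 0)) (c : ℝ≥0∞) :
    stepOp X P q (fun _ => c) = fun _ => c * stepDiscount X P q := by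
  funext y
  rw [stepOp, lintegral_mul_const _ (by fun_prop), mul_comm, stepDiscount]

/-- Durations are almost surely positive, so the discount is almost surely below 1. This strict
inequality yields all the geometric convergence and the contradiction in `IsIIDSteps.value_zero`. -/
lemma IsIIDSteps.stepDiscount_lt_one [IsProbabilityMeasure P] (hX : IsIIDSteps X P) (hq : 0 < q) :
    stepDiscount X P q < 1 := by
  have h0 := hX.measurable 0
  have hlt : ∀ᵐ ω ∂P, ENNReal.ofReal (Real.exp (-q * ((X 0 ω).2 : ℝ))) < 1 := by
    filter_upwards [hX.pos] with ω h
    have : (0 : ℝ) < (X 0 ω).2 := h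
    rw [← ENNReal.ofReal_one]
    refine (ENNReal.ofReal_lt_ofReal_iff one_pos).2 (Real.exp_lt_one_iff.2 ?_)
    nlinarith
  have h1 : stepDiscount X P q ≤ 1 := by
    calc _ ≤ ∫⁻ _, 1 ∂P := lintegral_mono_ae (hlt.mono fun _ h => h.le)
      _ = 1 := by simp
  calc _ < ∫⁻ _, 1 ∂P := lintegral_strict_mono (IsProbabilityMeasure.ne_zero P)
          aemeasurable_const (h1.trans_lt ENNReal.one_lt_top).ne hlt
    _ = 1 := by simp

lemma IsIIDSteps.occ_univ_const [IsProbabilityMeasure P] (hX : IsIIDSteps X P) (n : ℕ)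
    (c : ℝ≥0∞) : occ X P q univ n (fun _ => c) = c * stepDiscount X P q ^ n := by
  induction n generalizing c with
  | zero => simp [occ]
  | succ n ih =>
    rw [hX.occ_succ MeasurableSet.univ measurable_const, stepOp_const (hX.measurable 0), ih,
      pow_succ, mul_assoc, mul_comm (stepDiscount X P q)]

lemma occ_mono_set {D D' : Set Ω} (h : D ≤ᵐ[P] D') (n : ℕ) (g : ℝ → ℝ≥0∞) :
    occ X P q D n g ≤ occ X P q D' n g := lintegral_mono_set' h

lemma occ_mono (D : Set Ω) (n : ℕ) {g g' : ℝ → ℝ≥0∞} (h : g ≤ g') :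
    occ X P q D n g ≤ occ X P q D n g' := lintegral_mono fun _ => by gcongr; exact h _

lemma occ_add (hX : ∀ n, Measurable (X n)) (D : Set Ω) (n : ℕ) {g g' : ℝ → ℝ≥0∞}
    (hg : Measurable g) :
    occ X P q D n (g + g') = occ X P q D n g + occ X P q D n g' := by
  rw [occ, occ, occ, ← lintegral_add_left (measurable_occ_integrand hX n hg)]
  simp [mul_add]

end

/-! ### Optimal stopping for a monotone running reward. -/

section

variable {Ω : Type*} [MeasurableSpace Ω]

variable {X : ℕ → Ω → ℝ × ℝ≥0} {P : Measure Ω} {q : ℝ} {h : ℝ → ℝ}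

/-- The event that the walk is strictly positive at the times `1, …, n`. -/
def stay (X : ℕ → Ω → ℝ × ℝ≥0) (n : ℕ) : Set Ω :=
  {ω | ∀ j ∈ Finset.Icc 1 n, 0 < walk (X · ω) j}

omit [MeasurableSpace Ω] in
lemma stay_zero : stay X 0 = univ := by simp [stay]

omit [MeasurableSpace Ω] in
lemma stay_succ_subset (n : ℕ) : stay X (n + 1) ⊆ stay X n := fun _ h j hj =>
  h j (Finset.mem_Icc.2 ⟨(Finset.mem_Icc.1 hj).1, (Finset.mem_Icc.1 hj).2.trans n.le_succ⟩)

omit [MeasurableSpace Ω] in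
lemma walk_nonneg_of_mem_stay {n : ℕ} {ω : Ω} (h : ω ∈ stay X n) : 0 ≤ walk (X · ω) n := by
  rcases n.eq_zero_or_pos with rfl | hn
  · simp
  · exact (h n (Finset.mem_Icc.2 ⟨hn, le_rfl⟩)).le

omit [MeasurableSpace Ω] in
lemma walk_nonpos_of_mem_diff {n : ℕ} {ω : Ω} (h : ω ∈ stay X n \ stay X (n + 1)) :
    walk (X · ω) (n + 1) ≤ 0 := by
  by_contra! h'
  refine h.2 fun j hj => ?_
  rcases (Finset.mem_Icc.1 hj).2.lt_or_eq with h1 | rfl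
  · exact h.1 j (Finset.mem_Icc.2 ⟨(Finset.mem_Icc.1 hj).1, Nat.lt_succ_iff.1 h1⟩)
  · exact h'

omit [MeasurableSpace Ω] in
lemma measurableSet_past_stay {m n : ℕ} (hmn : m ≤ n) : MeasurableSet[past X n] (stay X m) := by
  have : stay X m = ⋂ j ∈ Finset.Icc 1 m, {ω | 0 < walk (X · ω) j} := by
    ext; simp [stay]
  rw [this]
  refine Finset.measurableSet_biInter _ fun j hj => ?_
  exact (measurable_past_walk ((Finset.mem_Icc.1 hj).2.trans hmn)) measurableSet_Ioi

lemma occ_stay (hX : ∀ n, Measurable (X n)) (n : ℕ) (g : ℝ → ℝ≥0∞) :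
    occ X P q (stay X n) (n + 1) g = occ X P q (stay X (n + 1)) (n + 1) g +
      occ X P q (stay X n \ stay X (n + 1)) (n + 1) g := by
  unfold occ
  rw [← lintegral_inter_add_sdiff _ _
    (past_le hX _ _ (measurableSet_past_stay (X := X) (le_refl (n + 1)))),
    inter_eq_self_of_subset_right (stay_succ_subset n)]

/-- Value iteration for the optimal stopping problem with running reward `h`. -/
def valueIter (X : ℕ → Ω → ℝ × ℝ≥0) (P : Measure Ω) (q : ℝ) (h : ℝ → ℝ) : ℕ → ℝ → ℝ≥0∞
  | 0 => 0
  | n + 1 => fun y =>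
      (ENNReal.ofReal (h y) + stepOp X P q (valueIter X P q h n) y) - ENNReal.ofReal (-h y)

/-- Value of the optimal stopping problem with running reward `h`. -/
def value (X : ℕ → Ω → ℝ × ℝ≥0) (P : Measure Ω) (q : ℝ) (h : ℝ → ℝ) (y : ℝ) : ℝ≥0∞ :=
  ⨆ n, valueIter X P q h n y

/-- Raising the starting point raises the positive part of the reward and the continuation value,
and lowers the negative part that is subtracted. -/
lemma monotone_valueIter_apply (hh : Monotone h) (n : ℕ) : Monotone (valueIter X P q h n) := by
  induction n with
  | zero => exact fun _ _ _ => le_rfl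
  | succ n ih =>
    intro y y' hy
    have := monotone_stepOp (X := X) (P := P) (q := q) ih hy
    have := hh hy
    simp only [valueIter]
    gcongr

lemma monotone_valueIter : Monotone (valueIter X P q h) := by
  refine monotone_nat_of_le_succ fun n => ?_
  induction n with
  | zero => exact fun _ => zero_le
  | succ n ih =>
    exact fun y => tsub_le_tsub_right (add_le_add_right (stepOp_mono ih y) _) _

lemma monotone_value (hh : Monotone h) : Monotone (value X P q h) :=
  fun _ _ hy => iSup_mono fun n => monotone_valueIter_apply hh n hy

lemma stepOp_value (hX : Measurable (X 0)) (hh : Monotone h) (y : ℝ) :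
    stepOp X P q (value X P q h) y = ⨆ n, stepOp X P q (valueIter X P q h n) y := by
  unfold stepOp value
  rw [← lintegral_iSup]
  · simp [ENNReal.mul_iSup]
  · intro n
    have := (monotone_valueIter_apply (X := X) (P := P) (q := q) hh n).measurable
    fun_prop
  · intro m n hmn ω
    have := monotone_valueIter (X := X) (P := P) (q := q) (h := h) hmn (y + (X 0 ω).1)
    dsimp only
    gcongr

/-- Bellman's equation, obtained from the iteration by monotone convergence. Truncated subtraction
of the negative part of `h` encodes the maximum of 0 (stop) and the value of continuing. -/
lemma value_eq (hX : Measurable (X 0)) (hh : Monotone h) (y : ℝ) :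
    value X P q h y =
      (ENNReal.ofReal (h y) + stepOp X P q (value X P q h) y) - ENNReal.ofReal (-h y) := by
  rw [stepOp_value hX hh, ENNReal.add_iSup, ENNReal.iSup_sub, value]
  refine le_antisymm (iSup_le fun n => ?_) (iSup_le fun n => le_iSup_of_le (n + 1) le_rfl)
  exact le_iSup_of_le n (monotone_valueIter n.le_succ y)

variable [IsProbabilityMeasure P]

/-- Forgetting the negative rewards only increases the value. The bound is the tail of a series,
which makes the remainder vanish when Bellman's equation is iterated. -/
lemma IsIIDSteps.occ_value_le (hX : IsIIDSteps X P) (hh : Monotone h) (j : ℕ) :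
    occ X P q univ j (value X P q h) ≤
      ∑' i, occ X P q univ (i + j) (fun y => ENNReal.ofReal (h y)) := by
  have key : ∀ n j, occ X P q univ j (valueIter X P q h n) ≤
      ∑ i ∈ Finset.range n, occ X P q univ (i + j) (fun y => ENNReal.ofReal (h y)) := by
    intro n
    induction n with
    | zero => intro j; simp [occ, valueIter]
    | succ n ih =>
      intro j
      have hm := (monotone_valueIter_apply (X := X) (P := P) (q := q) hh n).measurable
      have hm' := hh.measurable
      calc _ ≤ occ X P q univ j ((fun y => ENNReal.ofReal (h y)) +
              stepOp X P q (valueIter X P q h n)) :=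
            occ_mono _ _ fun y => tsub_le_self
        _ = occ X P q univ j (fun y => ENNReal.ofReal (h y)) +
              occ X P q univ (j + 1) (valueIter X P q h n) := by
            rw [occ_add hX.measurable _ _ (by fun_prop), hX.occ_succ MeasurableSet.univ hm]
        _ ≤ occ X P q univ j (fun y => ENNReal.ofReal (h y)) + _ :=
            add_le_add_right (ih (j + 1)) _
        _ = _ := by
            rw [Finset.sum_range_succ', add_comm, zero_add]
            simp only [add_assoc, add_comm 1]
  have hsup : occ X P q univ j (value X P q h) = ⨆ n, occ X P q univ j (valueIter X P q h n) := by
    unfold occ value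
    rw [← lintegral_iSup]
    · simp [ENNReal.mul_iSup]
    · exact fun n => measurable_occ_integrand hX.measurable j
        (monotone_valueIter_apply hh n).measurable
    · intro m n hmn ω
      have := monotone_valueIter (X := X) (P := P) (q := q) (h := h) hmn (walk (X · ω) j)
      dsimp only
      gcongr
  rw [hsup]
  exact iSup_le fun n => (key n j).trans (ENNReal.sum_le_tsum _)

/-- The exit takes at least one step, so its discount is on average at most that of one step. -/
lemma IsIIDSteps.sum_exit_le (hX : IsIIDSteps X P) (hq : 0 < q) (n : ℕ) :
    ∑ k ∈ Finset.range n, occ X P q (stay X k \ stay X (k + 1)) (k + 1) (fun _ => 1) ≤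
      stepDiscount X P q := by
  -- The added term is the discounted mass that has not yet left, carried one more step; with it the
  -- left side is nonincreasing in `n`.
  suffices H : ∑ k ∈ Finset.range n, occ X P q (stay X k \ stay X (k + 1)) (k + 1) (fun _ => 1) +
      stepDiscount X P q * occ X P q (stay X n) n (fun _ => 1) ≤ stepDiscount X P q from
    le_self_add.trans H
  induction n with
  | zero => simp [stay_zero, hX.occ_univ_const]
  | succ n ih =>
    refine le_trans ?_ ih
    have h1 : stepDiscount X P q * occ X P q (stay X n) n (fun _ => 1) =
        occ X P q (stay X n) (n + 1) (fun _ => 1) := by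
      rw [hX.occ_succ (measurableSet_past_stay le_rfl) measurable_const,
        stepOp_const (hX.measurable 0), occ, occ, ← lintegral_const_mul]
      · simp [mul_comm]
      · exact measurable_occ_integrand hX.measurable n measurable_const
    rw [h1, occ_stay hX.measurable, Finset.sum_range_succ, add_assoc,
      add_comm (occ X P q (stay X (n + 1)) _ _)]
    gcongr
    exact mul_le_of_le_one_left zero_le (hX.stepDiscount_lt_one hq).le

/-- If the discounted rewards `h` up to the first return to `(-∞, 0]` balance, then the value of
the optimal stopping problem at `0` vanishes. -/
lemma IsIIDSteps.value_zero (hX : IsIIDSteps X P) (hq : 0 < q) (hh : Monotone h)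
    (hpos : ∑' n, occ X P q univ n (fun y => ENNReal.ofReal (h y)) ≠ ∞)
    (hneg : ∑' n, occ X P q univ n (fun y => ENNReal.ofReal (-h y)) ≠ ∞)
    (hbal : ∑' n, occ X P q (stay X n) n (fun y => ENNReal.ofReal (h y)) ≤
      ∑' n, occ X P q (stay X n) n (fun y => ENNReal.ofReal (-h y))) :
    value X P q h 0 = 0 := by
  set V := value X P q h with hV
  set p := fun y => ENNReal.ofReal (h y) with hp
  set m := fun y => ENNReal.ofReal (-h y) with hm
  have hVm : Measurable V := (monotone_value hh).measurable
  have hhm := hh.measurable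
  have hpm : Measurable p := by fun_prop
  have hmm : Measurable m := by fun_prop
  by_contra hV0
  -- On `[0, ∞)` monotonicity gives `V y ≥ V 0 > 0`, so the truncation in Bellman's equation is
  -- inactive there.
  have hVeq : ∀ y, 0 ≤ y → V y + m y = p y + stepOp X P q V y := by
    intro y hy
    have h0 : 0 < V y := (pos_iff_ne_zero.2 hV0).trans_le (monotone_value hh hy)
    rw [hV, value_eq (hX.measurable 0) hh] at h0 ⊢
    exact tsub_add_cancel_of_le (tsub_pos_iff_lt.1 h0).le
  have hV0fin : V 0 ≠ ∞ := by
    have h1 := hX.occ_value_le (q := q) hh 0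
    have h2 : occ X P q univ 0 (value X P q h) = V 0 := by simp [occ, hV]
    exact ((h2 ▸ h1).trans_lt (lt_top_iff_ne_top.2 hpos)).ne
  -- Bellman's equation unrolled `n` times along paths that stay positive. A path that leaves lands
  -- in `(-∞, 0]`, where `V` is at most `V 0`. Negative rewards are kept on the left, so nothing is
  -- subtracted in `ℝ≥0∞`.
  have hiter : ∀ n, V 0 + ∑ k ∈ Finset.range n, occ X P q (stay X k) k m ≤
      ∑ k ∈ Finset.range n, occ X P q (stay X k) k p + occ X P q (stay X n) n V +
        V 0 * ∑ k ∈ Finset.range n,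
          occ X P q (stay X k \ stay X (k + 1)) (k + 1) (fun _ => 1) := by
    intro n
    induction n with
    | zero => simp [stay_zero, occ]
    | succ n ih =>
      have hS := measurableSet_past_stay (X := X) (le_refl n)
      have e1 : occ X P q (stay X n) n V + occ X P q (stay X n) n m =
          occ X P q (stay X n) n p + occ X P q (stay X n) (n + 1) V := by
        rw [hX.occ_succ hS hVm, ← occ_add hX.measurable _ _ hVm, ← occ_add hX.measurable _ _ hpm]
        refine setLIntegral_congr_fun (past_le hX.measurable _ _ hS) fun ω hω => ?_
        simp only [Pi.add_apply]
        rw [hVeq _ (walk_nonneg_of_mem_stay hω)]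
      have e2 : occ X P q (stay X n) (n + 1) V ≤ occ X P q (stay X (n + 1)) (n + 1) V +
          V 0 * occ X P q (stay X n \ stay X (n + 1)) (n + 1) (fun _ => 1) := by
        have hS' := past_le hX.measurable _ _ (measurableSet_past_stay (X := X) (le_refl (n + 1)))
        rw [occ_stay hX.measurable]
        gcongr
        unfold occ
        rw [← lintegral_const_mul _ (measurable_occ_integrand hX.measurable _ measurable_const)]
        refine setLIntegral_mono' ((past_le hX.measurable _ _ hS).diff hS') fun ω hω => ?_
        rw [mul_one, mul_comm]
        gcongr
        exact monotone_value hh (walk_nonpos_of_mem_diff hω)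
      rw [Finset.sum_range_succ, Finset.sum_range_succ, Finset.sum_range_succ, ← add_assoc]
      calc _ ≤ ∑ k ∈ Finset.range n, occ X P q (stay X k) k p + occ X P q (stay X n) n V +
            V 0 * ∑ k ∈ Finset.range n,
              occ X P q (stay X k \ stay X (k + 1)) (k + 1) (fun _ => 1) +
              occ X P q (stay X n) n m := by gcongr
        _ = ∑ k ∈ Finset.range n, occ X P q (stay X k) k p +
              (occ X P q (stay X n) n V + occ X P q (stay X n) n m) +
            V 0 * ∑ k ∈ Finset.range n,
              occ X P q (stay X k \ stay X (k + 1)) (k + 1) (fun _ => 1) := by ring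
        _ ≤ ∑ k ∈ Finset.range n, occ X P q (stay X k) k p +
              (occ X P q (stay X n) n p + (occ X P q (stay X (n + 1)) (n + 1) V +
          V 0 * occ X P q (stay X n \ stay X (n + 1)) (n + 1) (fun _ => 1))) +
            V 0 * ∑ k ∈ Finset.range n,
              occ X P q (stay X k \ stay X (k + 1)) (k + 1) (fun _ => 1) := by
            rw [e1]; gcongr
        _ = _ := by ring
  have hMfin : ∑' n, occ X P q (stay X n) n m ≠ ∞ :=
    ((ENNReal.tsum_le_tsum fun n => occ_mono_set (subset_univ _).eventuallyLE n m).trans_lt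
      (lt_top_iff_ne_top.2 hneg)).ne
  -- The `0` on the right is the limit of the remainder, which `IsIIDSteps.occ_value_le` bounds by a
  -- vanishing tail.
  have hlim : V 0 + ∑' n, occ X P q (stay X n) n m ≤
      ∑' n, occ X P q (stay X n) n p + 0 + V 0 * stepDiscount X P q := by
    refine le_of_tendsto_of_tendsto' (f := fun n =>
        V 0 + ∑ k ∈ Finset.range n, occ X P q (stay X k) k m)
      (g := fun n => ∑' n, occ X P q (stay X n) n p + ∑' i, occ X P q univ (i + n) p +
        V 0 * stepDiscount X P q) (b := atTop)
      (tendsto_const_nhds.add ENNReal.summable.hasSum.tendsto_sum_nat)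
      ((tendsto_const_nhds.add (ENNReal.tendsto_sum_nat_add _ hpos)).add tendsto_const_nhds)
      fun n => (hiter n).trans ?_
    gcongr
    · exact ENNReal.sum_le_tsum _
    · exact (occ_mono_set (subset_univ _).eventuallyLE _ _).trans (hX.occ_value_le hh n)
    · exact hX.sum_exit_le hq n
  -- The balance hypothesis lets the finite total of negative rewards cancel.
  have hfin : V 0 ≤ V 0 * stepDiscount X P q := by
    refine (ENNReal.add_le_add_iff_right hMfin).1 (hlim.trans ?_)
    rw [add_zero, add_comm]
    gcongr
  have hlt : V 0 * stepDiscount X P q < V 0 * 1 :=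
    (ENNReal.mul_lt_mul_iff_right hV0 hV0fin).2 (hX.stepDiscount_lt_one hq)
  rw [mul_one] at hlt
  exact absurd hfin hlt.not_ge

/-- Under the balance condition no stopping rule has a positive discounted reward. Here `D k` is
the event that the rule has not stopped by time `k`. -/
theorem IsIIDSteps.tsum_occ_le (hX : IsIIDSteps X P) (hq : 0 < q) (hh : Monotone h)
    (hpos : ∑' n, occ X P q univ n (fun y => ENNReal.ofReal (h y)) ≠ ∞)
    (hneg : ∑' n, occ X P q univ n (fun y => ENNReal.ofReal (-h y)) ≠ ∞)
    (hbal : ∑' n, occ X P q (stay X n) n (fun y => ENNReal.ofReal (h y)) ≤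
      ∑' n, occ X P q (stay X n) n (fun y => ENNReal.ofReal (-h y)))
    {D : ℕ → Set Ω} (hD : ∀ n, MeasurableSet[past X n] (D n))
    (hanti : ∀ n, D (n + 1) ≤ᵐ[P] D n) :
    ∑' n, occ X P q (D n) n (fun y => ENNReal.ofReal (h y)) ≤
      ∑' n, occ X P q (D n) n (fun y => ENNReal.ofReal (-h y)) := by
  have hV0 := hX.value_zero hq hh hpos hneg hbal
  set V := value X P q h with hV
  set p := fun y => ENNReal.ofReal (h y) with hp
  set m := fun y => ENNReal.ofReal (-h y) with hm
  have hVm : Measurable V := (monotone_value hh).measurable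
  have hhm := hh.measurable
  have hpm : Measurable p := by fun_prop
  have hmm : Measurable m := by fun_prop
  -- `V` dominates the reward plus the continuation value at every point, so the collected reward
  -- plus the current value never exceeds the initial value, which is 0. Shrinking `D` only discards
  -- nonnegative `V`.
  have hiter : ∀ n, ∑ k ∈ Finset.range n, occ X P q (D k) k p + occ X P q (D n) n V ≤
      ∑ k ∈ Finset.range n, occ X P q (D k) k m := by
    intro n
    induction n with
    | zero => simp [occ, hV0]
    | succ n ih =>
      have e1 : occ X P q (D n) n p + occ X P q (D (n + 1)) (n + 1) V ≤
          occ X P q (D n) n V + occ X P q (D n) n m := by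
        calc _ ≤ occ X P q (D n) n p + occ X P q (D n) (n + 1) V := by
              gcongr
              exact occ_mono_set (hanti n) _ _
          _ ≤ _ := by
            rw [hX.occ_succ (hD n) hVm, ← occ_add hX.measurable _ _ hVm,
              ← occ_add hX.measurable _ _ hpm]
            refine occ_mono _ _ fun y => ?_
            simp only [Pi.add_apply]
            rw [hV, value_eq (hX.measurable 0) hh]
            exact le_tsub_add
      rw [Finset.sum_range_succ, Finset.sum_range_succ, add_assoc]
      refine (add_le_add_right e1 _).trans ?_
      rw [← add_assoc]
      gcongr
  refine ENNReal.tsum_le_of_sum_range_le fun n => ?_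
  exact (le_self_add.trans (hiter n)).trans (ENNReal.sum_le_tsum _)

end

/-! ### Wiener–Hopf factorization of the discounted walk. -/

section

variable {Ω : Type*} [MeasurableSpace Ω]

/-- The integrand `exp (-q T_n + i θ S_n)` of the transforms, as a function of the steps. -/
def waveExp (q θ : ℝ) (x : ℕ → ℝ × ℝ≥0) (n : ℕ) : ℂ :=
  Complex.exp (-(q : ℂ) * ((clock x n : ℝ) : ℂ) + Complex.I * θ * (walk x n : ℂ))

/-- `E[exp (-q T_n + i θ S_n); D]`. -/
def transform (X : ℕ → Ω → ℝ × ℝ≥0) (P : Measure Ω) (q θ : ℝ) (D : Set Ω) (n : ℕ) : ℂ :=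
  ∫ ω in D, waveExp q θ (X · ω) n ∂P

/-- The event that `n` is a strict ascending ladder epoch. -/
def ladder (X : ℕ → Ω → ℝ × ℝ≥0) (n : ℕ) : Set Ω :=
  {ω | ∀ j < n, walk (X · ω) j < walk (X · ω) n}

/-- The event that `n + 1` is the first strict ascending ladder epoch. -/
def firstAscent (X : ℕ → Ω → ℝ × ℝ≥0) (n : ℕ) : Set Ω :=
  {ω | (∀ j ∈ Finset.Icc 1 n, walk (X · ω) j ≤ 0) ∧ 0 < walk (X · ω) (n + 1)}

variable {X : ℕ → Ω → ℝ × ℝ≥0} {P : Measure Ω} {q θ : ℝ}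

@[simp] lemma waveExp_zero (x : ℕ → ℝ × ℝ≥0) : waveExp q θ x 0 = 1 := by simp [waveExp]

lemma walk_add (x : ℕ → ℝ × ℝ≥0) (m n : ℕ) :
    walk x (m + n) = walk x m + walk (fun i => x (m + i)) n := Finset.sum_range_add _ _ _

lemma clock_add (x : ℕ → ℝ × ℝ≥0) (m n : ℕ) :
    clock x (m + n) = clock x m + clock (fun i => x (m + i)) n := Finset.sum_range_add _ _ _

lemma waveExp_add (x : ℕ → ℝ × ℝ≥0) (m n : ℕ) :
    waveExp q θ x (m + n) = waveExp q θ x m * waveExp q θ (fun i => x (m + i)) n := by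
  simp only [waveExp, walk_add, clock_add, ← Complex.exp_add]
  push_cast
  ring_nf

lemma norm_waveExp (x : ℕ → ℝ × ℝ≥0) (n : ℕ) :
    ‖waveExp q θ x n‖ = Real.exp (-q * (clock x n : ℝ)) := by
  simp [waveExp, Complex.norm_exp]

lemma measurable_waveExp (n : ℕ) : Measurable (fun x : ℕ → ℝ × ℝ≥0 => waveExp q θ x n) := by
  have := measurable_walk n
  have := measurable_clock n
  unfold waveExp; fun_prop

omit [MeasurableSpace Ω] in
lemma measurable_past_waveExp (n : ℕ) :
    Measurable[past X n] (fun ω => waveExp q θ (X · ω) n) := by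
  have h1 : Measurable (fun p : ℝ × ℝ≥0 =>
      Complex.exp (-(q : ℂ) * ((p.2 : ℝ) : ℂ) + Complex.I * θ * (p.1 : ℂ))) := by fun_prop
  exact h1.comp ((measurable_past_walk le_rfl).prodMk (measurable_past_clock le_rfl))

lemma norm_waveExp_le (hq : 0 < q) (x : ℕ → ℝ × ℝ≥0) (n : ℕ) : ‖waveExp q θ x n‖ ≤ 1 := by
  rw [norm_waveExp, Real.exp_le_one_iff]
  have : (0 : ℝ) ≤ clock x n := NNReal.coe_nonneg _
  nlinarith

lemma measurableSet_ladder (n : ℕ) : MeasurableSet (ladder (fun k (x : ℕ → ℝ × ℝ≥0) => x k) n) := by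
  have : ladder (fun k (x : ℕ → ℝ × ℝ≥0) => x k) n =
      ⋂ j ∈ Finset.range n, {x | walk x j < walk x n} := by
    ext; simp [ladder]
  rw [this]
  exact Finset.measurableSet_biInter _ fun j _ =>
    measurableSet_lt (measurable_walk j) (measurable_walk n)

omit [MeasurableSpace Ω] in
lemma measurableSet_past_firstAscent (n : ℕ) :
    MeasurableSet[past X (n + 1)] (firstAscent X n) := by
  have : firstAscent X n = (⋂ j ∈ Finset.Icc 1 n, {ω | walk (X · ω) j ≤ 0}) ∩
      {ω | 0 < walk (X · ω) (n + 1)} := by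
    ext; simp [firstAscent]
  rw [this]
  refine MeasurableSet.inter (Finset.measurableSet_biInter _ fun j hj => ?_) ?_
  · exact measurable_past_walk ((Finset.mem_Icc.1 hj).2.trans n.le_succ) measurableSet_Iic
  · exact measurable_past_walk le_rfl measurableSet_Ioi

lemma measurable_steps (hX : ∀ n, Measurable (X n)) : Measurable (fun ω => (X · ω)) :=
  measurable_pi_lambda _ hX

lemma integrable_waveExp [IsFiniteMeasure P] (hX : ∀ n, Measurable (X n)) (hq : 0 < q) (n : ℕ) :
    Integrable (fun ω => waveExp q θ (X · ω) n) P :=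
  Integrable.of_bound ((measurable_waveExp n).comp (measurable_steps hX)).aestronglyMeasurable 1
    (ae_of_all _ fun _ => norm_waveExp_le hq _ _)

variable [IsProbabilityMeasure P]

lemma IsIIDSteps.integral_norm_waveExp (hX : IsIIDSteps X P) (n : ℕ) :
    ∫ ω, ‖waveExp q θ (X · ω) n‖ ∂P = (stepDiscount X P q).toReal ^ n := by
  rw [integral_eq_lintegral_of_nonneg_ae (ae_of_all _ fun _ => norm_nonneg _)
    (f := fun ω => ‖waveExp q θ (X · ω) n‖)
    ((measurable_waveExp n).comp (measurable_steps hX.measurable)).norm.aestronglyMeasurable,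
    ← ENNReal.toReal_pow, ← one_mul (_ ^ n), ← hX.occ_univ_const n 1]
  simp [norm_waveExp, occ, discount]

lemma IsIIDSteps.norm_transform_le (hX : IsIIDSteps X P) (hq : 0 < q) (D : Set Ω) (n : ℕ) :
    ‖transform X P q θ D n‖ ≤ (stepDiscount X P q).toReal ^ n := by
  rw [← hX.integral_norm_waveExp (θ := θ)]
  refine (norm_integral_le_integral_norm _).trans ?_
  exact setIntegral_le_integral (integrable_waveExp hX.measurable hq n).norm
    (ae_of_all _ fun _ => norm_nonneg _)

lemma IsIIDSteps.summable_geometric (hX : IsIIDSteps X P) (hq : 0 < q) :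
    Summable fun n => (stepDiscount X P q).toReal ^ n := by
  refine summable_geometric_of_lt_one ENNReal.toReal_nonneg ?_
  simpa using (ENNReal.toReal_lt_toReal ((hX.stepDiscount_lt_one hq).trans_le le_top).ne
    ENNReal.one_ne_top).2 (hX.stepDiscount_lt_one hq)

omit [IsProbabilityMeasure P] in
-- Both sequences have the same infinite product law. It is used for the shift and for the time
-- reversal.
lemma IsIIDSteps.integral_comp_injective (hX : IsIIDSteps X P) {σ : ℕ → ℕ} (hσ : σ.Injective)
    {F : (ℕ → ℝ × ℝ≥0) → ℂ} (hF : Measurable F) :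
    ∫ ω, F (fun i => X (σ i) ω) ∂P = ∫ ω, F (fun i => X i ω) ∂P := by
  have h1 := (hX.indep.precomp hσ).map_fun_eq_infinitePi_map fun i => hX.measurable (σ i)
  have h2 := hX.indep.map_fun_eq_infinitePi_map hX.measurable
  have h3 : (fun i => P.map (X (σ i))) = fun i => P.map (X i) :=
    funext fun i => ((hX.identDistrib (σ i)).map_eq).trans (hX.identDistrib i).map_eq.symm
  rw [h3, ← h2] at h1
  have h4 := integral_map (μ := P) (φ := fun ω i => X (σ i) ω)
    (measurable_pi_lambda _ fun i => hX.measurable (σ i)).aemeasurable hF.aestronglyMeasurable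
  rw [h1, integral_map (measurable_pi_lambda _ hX.measurable).aemeasurable
    hF.aestronglyMeasurable] at h4
  exact h4.symm

omit [IsProbabilityMeasure P] in
lemma IsIIDSteps.integral_past_mul_shift (hX : IsIIDSteps X P) {m : ℕ} {C : Ω → ℂ}
    (hC : Measurable[past X m] C) {F : (ℕ → ℝ × ℝ≥0) → ℂ} (hF : Measurable F) :
    ∫ ω, C ω * F (fun i => X (m + i) ω) ∂P = (∫ ω, C ω ∂P) * ∫ ω, F (X · ω) ∂P := by
  rw [← hX.integral_comp_injective (add_right_injective m) hF]
  have hfut : Measurable[⨆ i ∈ Ici m, (inferInstance : MeasurableSpace (ℝ × ℝ≥0)).comap (X i)]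
      (fun ω i => X (m + i) ω) := by
    refine @measurable_pi_lambda _ _ _ (_) _ _ fun i => ?_
    exact (comap_measurable (X (m + i))).mono (le_biSup (fun i =>
      (inferInstance : MeasurableSpace (ℝ × ℝ≥0)).comap (X i)) (mem_Ici.2 (m.le_add_right i))) le_rfl
  refine IndepFun.integral_fun_mul_eq_mul_integral (Y := fun ω => F (fun i => X (m + i) ω)) ?_
    (hC.mono (past_le hX.measurable m) le_rfl).aestronglyMeasurable
    (hF.comp (measurable_pi_lambda _ fun i => hX.measurable (m + i))).aestronglyMeasurable
  rw [IndepFun_iff_Indep]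
  exact indep_of_indep_of_le_left (indep_of_indep_of_le_right (hX.indep_future m)
    (hF.comp hfut).comap_le) hC.comap_le

omit [IsProbabilityMeasure P] in
-- The exponential is multiplicative along concatenated paths, and the steps after time `m` are an
-- independent copy of the whole sequence.
lemma IsIIDSteps.transform_inter_shift (hX : IsIIDSteps X P) {m : ℕ} {D : Set Ω}
    (hD : MeasurableSet[past X m] D) {G : Set (ℕ → ℝ × ℝ≥0)} (hG : MeasurableSet G) (n : ℕ) :
    transform X P q θ (D ∩ {ω | (fun i => X (m + i) ω) ∈ G}) (m + n) =
      transform X P q θ D m * transform X P q θ {ω | (X · ω) ∈ G} n := by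
  have hD' := past_le hX.measurable m _ hD
  have hmX : ∀ m, Measurable fun ω i => X (m + i) ω :=
    fun m => measurable_pi_lambda _ fun i => hX.measurable (m + i)
  have := hX.integral_past_mul_shift ((measurable_past_waveExp (q := q) (θ := θ) m).indicator hD)
    ((measurable_waveExp (q := q) (θ := θ) n).indicator hG)
  rw [transform, transform, transform, ← integral_indicator hD',
    ← integral_indicator (s := D ∩ {ω | (fun i => X (m + i) ω) ∈ G}) (hD'.inter (hmX m hG)),
    ← integral_indicator (s := {ω | (X · ω) ∈ G}) (measurable_steps hX.measurable hG)]
  refine Eq.trans (integral_congr_ae (ae_of_all _ fun ω => ?_)) this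
  by_cases h1 : ω ∈ D <;> by_cases h2 : (fun i => X (m + i) ω) ∈ G <;>
    simp [h1, h2, waveExp_add]

omit [IsProbabilityMeasure P] in
lemma IsIIDSteps.transform_succ (hX : IsIIDSteps X P) {n : ℕ} {D : Set Ω}
    (hD : MeasurableSet[past X n] D) :
    transform X P q θ D (n + 1) = transform X P q θ D n * transform X P q θ univ 1 := by
  simpa using hX.transform_inter_shift (q := q) (θ := θ) hD MeasurableSet.univ 1

lemma walk_reverse (x : ℕ → ℝ × ℝ≥0) {n j : ℕ} (hj : j ≤ n) :
    walk (fun i => if i < n then x (n - 1 - i) else x i) j = walk x n - walk x (n - j) := by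
  induction j with
  | zero => simp
  | succ j ih =>
    have h1 : n - j = n - (j + 1) + 1 := by omega
    have h2 : n - 1 - j = n - (j + 1) := by omega
    rw [walk_succ, ih (by omega), h1, walk_succ, if_pos (by omega), h2]
    ring

lemma clock_reverse (x : ℕ → ℝ × ℝ≥0) (n : ℕ) :
    clock (fun i => if i < n then x (n - 1 - i) else x i) n = clock x n := by
  unfold clock
  rw [← Finset.sum_range_reflect]
  refine Finset.sum_congr rfl fun i hi => ?_
  have := Finset.mem_range.1 hi
  simp only [if_pos (show n - 1 - i < n by omega), show n - 1 - (n - 1 - i) = i by omega]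

omit [IsProbabilityMeasure P] in
/-- Duality: reversing the first `n` steps turns positivity up to `n` into `n` being a ladder
epoch. -/
lemma IsIIDSteps.transform_stay_eq_ladder (hX : IsIIDSteps X P) (n : ℕ) :
    transform X P q θ (stay X n) n = transform X P q θ (ladder X n) n := by
  -- Reverses the first `n` indices and fixes the others, which keeps it injective on all of `ℕ`.
  set σ : ℕ → ℕ := fun i => if i < n then n - 1 - i else i with hσ
  have hinj : σ.Injective := by
    intro i j hij
    simp only [hσ] at hij
    split_ifs at hij <;> omega
  have hS : MeasurableSet (stay (fun k (x : ℕ → ℝ × ℝ≥0) => x k) n) :=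
    past_le (fun k => measurable_pi_apply k) n _ (measurableSet_past_stay le_rfl)
  have h := hX.integral_comp_injective hinj
    ((measurable_waveExp (q := q) (θ := θ) n).indicator hS)
  have hmX := measurable_steps hX.measurable
  rw [transform, transform,
    ← integral_indicator (past_le hX.measurable n _ (measurableSet_past_stay le_rfl)),
    ← integral_indicator (s := ladder X n) (hmX (measurableSet_ladder n))]
  have e1 : ∀ ω, (fun i => X (σ i) ω) = fun i => if i < n then X (n - 1 - i) ω else X i ω := by
    intro ω; funext i; simp only [hσ]; split_ifs <;> rfl
  refine Eq.trans (Eq.trans rfl h.symm) (integral_congr_ae (ae_of_all _ fun ω => ?_))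
  -- The reversed walk at `j` is `walk n - walk (n - j)`; as `j` runs over `1, …, n`, the index `n -
  -- j` runs over all times before `n`.
  have e2 : (fun i => X (σ i) ω) ∈ stay (fun k (x : ℕ → ℝ × ℝ≥0) => x k) n ↔
      ω ∈ ladder X n := by
    rw [e1]
    simp only [stay, ladder, mem_ofPred_eq, Finset.mem_Icc]
    constructor
    · intro H j hj
      have := H (n - j) ⟨by omega, by omega⟩
      rw [walk_reverse (X · ω) (by omega), show n - (n - j) = j by omega] at this
      linarith
    · intro H j hj
      rw [walk_reverse (X · ω) (by omega)]
      have := H (n - j) (by omega)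
      linarith
  have e3 : waveExp q θ (fun i => X (σ i) ω) n = waveExp q θ (X · ω) n := by
    rw [e1, waveExp, walk_reverse (X · ω) le_rfl, clock_reverse (X · ω)]
    simp [waveExp]
  by_cases hω : ω ∈ ladder X n
  · simp [indicator_of_mem, e2.2 hω, hω, e3]
  · simp [indicator_of_notMem, mt e2.1 hω, hω]

omit [MeasurableSpace Ω] in
lemma firstAscent_unique {ω : Ω} {m n : ℕ} (hm : ω ∈ firstAscent X m)
    (hn : ω ∈ firstAscent X n) : m = n := by
  rcases lt_trichotomy m n with h | h | h
  · exact absurd hm.2 (hn.1 (m + 1) (Finset.mem_Icc.2 ⟨by omega, by omega⟩)).not_gt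
  · exact h
  · exact absurd hn.2 (hm.1 (n + 1) (Finset.mem_Icc.2 ⟨by omega, by omega⟩)).not_gt

omit [MeasurableSpace Ω] in
lemma exists_firstAscent {ω : Ω} {n : ℕ} (h : 0 < walk (X · ω) (n + 1)) :
    ∃ k ≤ n, ω ∈ firstAscent X k := by
  classical
  have hex : ∃ k, 0 < walk (X · ω) (k + 1) := ⟨n, h⟩
  refine ⟨Nat.find hex, Nat.find_min' hex h, fun j hj => ?_, Nat.find_spec hex⟩
  obtain ⟨h1, h2⟩ := Finset.mem_Icc.1 hj
  have := Nat.find_min hex (m := j - 1) (by omega)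
  rwa [not_lt, Nat.sub_add_cancel h1] at this

omit [MeasurableSpace Ω] in
-- Up to time `k` the walk is at most 0, and at time `k + 1` it is positive, so beating all
-- positions from `k + 1` on already implies beating the earlier ones.
lemma ladder_inter_firstAscent {k n : ℕ} (hk : k ≤ n) :
    ladder X (n + 1) ∩ firstAscent X k = firstAscent X k ∩
      {ω | (fun i => X (k + 1 + i) ω) ∈ ladder (fun k (x : ℕ → ℝ × ℝ≥0) => x k) (n - k)} := by
  ext ω
  rw [inter_comm]
  refine and_congr_right fun hA => ?_
  have e1 : ∀ i, walk (fun i => X (k + 1 + i) ω) i =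
      walk (X · ω) (k + 1 + i) - walk (X · ω) (k + 1) := by
    intro i; rw [walk_add]; ring
  simp only [ladder, mem_ofPred_eq, e1]
  rw [show k + 1 + (n - k) = n + 1 by omega]
  constructor
  · intro H j hj
    linarith [H (k + 1 + j) (by omega)]
  · intro H
    have key : ∀ j, k + 1 ≤ j → j < n + 1 → walk (X · ω) j < walk (X · ω) (n + 1) := by
      intro j h1 h2
      have := H (j - (k + 1)) (by omega)
      rw [show k + 1 + (j - (k + 1)) = j by omega] at this
      linarith
    have hpos : 0 < walk (X · ω) (n + 1) := by
      rcases hk.lt_or_eq with h | h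
      · exact hA.2.trans (key _ le_rfl (by omega))
      · exact h ▸ hA.2
    intro j hj
    by_cases hjk : j ≤ k
    · rcases j.eq_zero_or_pos with rfl | h0
      · simpa using hpos
      · exact (hA.1 j (Finset.mem_Icc.2 ⟨h0, hjk⟩)).trans_lt hpos
    · exact key j (by omega) hj

/-- Renewal equation for the strict ascending ladder epochs. -/
lemma IsIIDSteps.transform_ladder_succ (hX : IsIIDSteps X P) (hq : 0 < q) (n : ℕ) :
    transform X P q θ (ladder X (n + 1)) (n + 1) = ∑ k ∈ Finset.range (n + 1),
      transform X P q θ (firstAscent X k) (k + 1) * transform X P q θ (ladder X (n - k)) (n - k) := by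
  have hL := measurable_steps hX.measurable (measurableSet_ladder (n + 1))
  -- At a ladder epoch the walk exceeds its starting value 0, so a first ascent has occurred by
  -- then.
  have hunion : ladder X (n + 1) =
      ⋃ k ∈ Finset.range (n + 1), ladder X (n + 1) ∩ firstAscent X k := by
    ext ω
    simp only [mem_iUnion, Finset.mem_range, mem_inter_iff, exists_prop]
    refine ⟨fun h => ?_, fun ⟨_, _, h, _⟩ => h⟩
    obtain ⟨k, hk, hA⟩ := exists_firstAscent (X := X) (ω := ω) (n := n)
      (by simpa using h 0 n.succ_pos)
    exact ⟨k, by omega, h, hA⟩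
  rw [transform, hunion, integral_biUnion_finset]
  · refine Finset.sum_congr rfl fun k hk => ?_
    have hk' : k ≤ n := Nat.lt_succ_iff.1 (Finset.mem_range.1 hk)
    rw [ladder_inter_firstAscent hk']
    have := hX.transform_inter_shift (q := q) (θ := θ) (measurableSet_past_firstAscent k)
      (measurableSet_ladder (n - k)) (n - k)
    rw [show k + 1 + (n - k) = n + 1 by omega] at this
    exact this
  · exact fun k _ => MeasurableSet.inter hL
      (past_le hX.measurable _ _ (measurableSet_past_firstAscent k))
  · intro i _ j _ hij
    exact Set.disjoint_left.2 fun ω h1 h2 => hij (firstAscent_unique h1.2 h2.2)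
  · exact fun k _ => (integrable_waveExp hX.measurable hq _).integrableOn

/-- Discounted characteristic function of the occupation measure of `[0, ∞)` before the first
weak descending ladder epoch. -/
def occTransform (X : ℕ → Ω → ℝ × ℝ≥0) (P : Measure Ω) (q θ : ℝ) : ℂ :=
  ∑' n, transform X P q θ (stay X n) n

lemma IsIIDSteps.summable_norm_transform_stay (hX : IsIIDSteps X P) (hq : 0 < q) :
    Summable fun n => ‖transform X P q θ (stay X n) n‖ :=
  (hX.summable_geometric hq).of_nonneg_of_le (fun _ => norm_nonneg _)
    fun n => hX.norm_transform_le hq _ n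

lemma IsIIDSteps.summable_norm_transform_succ (hX : IsIIDSteps X P) (hq : 0 < q) (D : ℕ → Set Ω) :
    Summable fun n => ‖transform X P q θ (D n) (n + 1)‖ :=
  ((summable_nat_add_iff 1).2 (hX.summable_geometric hq)).of_nonneg_of_le
    (fun _ => norm_nonneg _) fun n => hX.norm_transform_le hq _ (n + 1)

lemma transform_zero (D : Set Ω) (hD : D = univ) : transform X P q θ D 0 = 1 := by
  simp [transform, hD]

/-- Wiener–Hopf factorization, ascending part. -/
theorem IsIIDSteps.one_sub_ascending_mul (hX : IsIIDSteps X P) (hq : 0 < q) :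
    (1 - ∑' n, transform X P q θ (firstAscent X n) (n + 1)) * occTransform X P q θ = 1 := by
  have hs := hX.summable_norm_transform_stay (θ := θ) hq
  have hf := hX.summable_norm_transform_succ (θ := θ) hq (firstAscent X)
  -- Through duality the renewal equation becomes a convolution in `n`, so summing it is a Cauchy
  -- product.
  have h := tsum_mul_tsum_eq_tsum_sum_range_of_summable_norm hf hs
  have h2 : occTransform X P q θ = 1 + ∑' n, transform X P q θ (stay X (n + 1)) (n + 1) := by
    rw [occTransform, hs.of_norm.tsum_eq_zero_add, transform_zero _ stay_zero]
  have h3 : ∀ n, transform X P q θ (stay X (n + 1)) (n + 1) = ∑ k ∈ Finset.range (n + 1),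
      transform X P q θ (firstAscent X k) (k + 1) * transform X P q θ (stay X (n - k)) (n - k) := by
    intro n
    simp only [hX.transform_stay_eq_ladder]
    exact hX.transform_ladder_succ hq n
  rw [sub_mul, one_mul]
  nth_rewrite 1 [h2]
  simp only [h3]
  rw [← h, occTransform]
  ring

/-- Wiener–Hopf factorization, descending part. -/
theorem IsIIDSteps.one_sub_descending (hX : IsIIDSteps X P) (hq : 0 < q) :
    1 - ∑' n, transform X P q θ (stay X n \ stay X (n + 1)) (n + 1) =
      (1 - transform X P q θ univ 1) * occTransform X P q θ := by
  have hs := (hX.summable_norm_transform_stay (θ := θ) hq).of_norm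
  have he := (hX.summable_norm_transform_succ (θ := θ) hq
    (fun n => stay X n \ stay X (n + 1))).of_norm
  -- One more independent step from a path that has stayed positive either stays positive or is the
  -- first exit.
  have h1 : ∀ n, transform X P q θ (stay X n) n * transform X P q θ univ 1 =
      transform X P q θ (stay X (n + 1)) (n + 1) +
        transform X P q θ (stay X n \ stay X (n + 1)) (n + 1) := by
    intro n
    rw [← hX.transform_succ (measurableSet_past_stay le_rfl)]
    unfold transform
    have := integral_inter_add_sdiff (μ := P) (s := stay X n) (t := stay X (n + 1))
      (f := fun ω => waveExp q θ (X · ω) (n + 1))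
      (past_le hX.measurable _ _ (measurableSet_past_stay le_rfl))
      (integrable_waveExp hX.measurable hq _).integrableOn
    rw [inter_eq_self_of_subset_right (stay_succ_subset n)] at this
    rw [← this]
  have h2 : occTransform X P q θ = 1 + ∑' n, transform X P q θ (stay X (n + 1)) (n + 1) := by
    rw [occTransform, hs.tsum_eq_zero_add, transform_zero _ stay_zero]
  have h3 : occTransform X P q θ * transform X P q θ univ 1 =
      ∑' n, transform X P q θ (stay X (n + 1)) (n + 1) +
        ∑' n, transform X P q θ (stay X n \ stay X (n + 1)) (n + 1) := by
    rw [occTransform, ← tsum_mul_right, ← ((summable_nat_add_iff 1).2 hs).tsum_add he]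
    exact tsum_congr h1
  linear_combination h3 - h2

end

/-! ### From the Lévy arm to i.i.d. steps. -/

section

variable {Ω : Type*} [MeasurableSpace Ω]

/-- A grid point of mesh `1 / (m + 1)` to the right of `t`. -/
def gridPoint (m : ℕ) (t : ℝ≥0) : ℝ≥0 := (⌊t * (m + 1)⌋₊ + 1) / (m + 1)

/-- Evaluation of a right-continuous path, as a limit along grid points. Unlike plain evaluation,
it is jointly measurable. -/
def pathEval (t : ℝ≥0) (y : ℝ≥0 → ℝ) : ℝ := limsup (fun m => y (gridPoint m t)) atTop

lemma lt_gridPoint (m : ℕ) (t : ℝ≥0) : t < gridPoint m t := by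
  rw [gridPoint, lt_div_iff₀ (by positivity)]
  exact Nat.lt_floor_add_one _

lemma gridPoint_le (m : ℕ) (t : ℝ≥0) : gridPoint m t ≤ t + 1 / (m + 1) := by
  have : (m + 1 : ℝ≥0) ≠ 0 := by positivity
  rw [gridPoint, add_div]
  gcongr
  rw [div_le_iff₀ (by positivity)]
  exact Nat.floor_le zero_le

lemma tendsto_gridPoint (t : ℝ≥0) : Tendsto (fun m => gridPoint m t) atTop (𝓝[Ici t] t) := by
  refine tendsto_nhdsWithin_iff.2 ⟨?_, Eventually.of_forall fun m => (lt_gridPoint m t).le⟩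
  have h : Tendsto (fun m : ℕ => t + 1 / ((m : ℝ≥0) + 1)) atTop (𝓝 (t + 0)) :=
    tendsto_const_nhds.add tendsto_one_div_add_atTop_nhds_zero_nat
  rw [add_zero] at h
  exact tendsto_of_tendsto_of_tendsto_of_le_of_le tendsto_const_nhds h
    (fun m => (lt_gridPoint m t).le) (fun m => gridPoint_le m t)

/-- For fixed `m` the grid point depends on `t` only through a natural number, so joint
measurability reduces to countably many coordinate evaluations. -/
lemma measurable_pathEval : Measurable (fun p : ℝ≥0 × (ℝ≥0 → ℝ) => pathEval p.1 p.2) := by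
  refine Measurable.limsup fun m => ?_
  have h1 : Measurable (fun p : ℕ × (ℝ≥0 → ℝ) => p.2 (((p.1 : ℝ≥0) + 1) / (m + 1))) :=
    measurable_from_prod_countable_right fun n =>
      measurable_pi_apply (((n : ℝ≥0) + 1) / (m + 1))
  have h2 : Measurable (fun p : ℝ≥0 × (ℝ≥0 → ℝ) => (⌊p.1 * (m + 1)⌋₊, p.2)) := by
    have : Measurable (fun t : ℝ≥0 => ⌊t * (m + 1)⌋₊) := Nat.measurable_floor.comp (by fun_prop)
    fun_prop
  exact h1.comp h2

lemma measurable_pathEval_comp {α : Type*} [MeasurableSpace α] {t : α → ℝ≥0} {y : α → ℝ≥0 → ℝ}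
    (ht : Measurable t) (hy : Measurable y) : Measurable fun a => pathEval (t a) (y a) := by
  have key : ∀ F : ℝ≥0 × (ℝ≥0 → ℝ) → ℝ, Measurable F → Measurable fun a => F (t a, y a) :=
    fun F hF => hF.comp (ht.prodMk hy)
  exact key (fun p => pathEval p.1 p.2) measurable_pathEval

lemma pathEval_eq {y : ℝ≥0 → ℝ} {t : ℝ≥0} (h : ContinuousWithinAt y (Ici t) t) :
    pathEval t y = y t :=
  (h.tendsto.comp (tendsto_gridPoint t)).limsup_eq

/-- The steps of a Lévy arm: the increments over the renewal intervals, and their lengths. -/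
def armStep (Y : ℝ≥0 → Ω → ℝ) (W : ℕ → Ω → ℝ≥0) (n : ℕ) (ω : Ω) : ℝ × ℝ≥0 :=
  (pathEval (T W (n + 1) ω) (Y · ω) - pathEval (T W n ω) (Y · ω), W n ω)

/-- Conditional probability that a step lies in `B`, given that its duration is `w`. -/
def stepProb (Y : ℝ≥0 → Ω → ℝ) (P : Measure Ω) (B : Set (ℝ × ℝ≥0)) (w : ℝ≥0) : ℝ≥0∞ :=
  P {ω | (Y w ω - Y 0 ω, w) ∈ B}

variable {Y : ℝ≥0 → Ω → ℝ} {W : ℕ → Ω → ℝ≥0} {P : Measure Ω}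

lemma IsLevyProcess.ae_pathEval (hY : IsLevyProcess Y P) :
    ∀ᵐ ω ∂P, ∀ t, pathEval t (Y · ω) = Y t ω := by
  filter_upwards [hY.cadlag] with ω hω t
  exact pathEval_eq (hω t).1

lemma IsLevyProcess.measurable_path (hY : IsLevyProcess Y P) : Measurable (fun ω t => Y t ω) :=
  measurable_pi_lambda _ hY.measurable

lemma IsRenewalSequence.measurable_T (hW : IsRenewalSequence W P) (n : ℕ) : Measurable (T W n) := by
  have := hW.measurable
  unfold T; fun_prop

lemma IsLevyArm.measurable_armStep (h : IsLevyArm Y W P) (n : ℕ) : Measurable (armStep Y W n) := by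
  have h1 : ∀ n, Measurable (fun ω => pathEval (T W n ω) (Y · ω)) := fun n =>
    measurable_pathEval_comp (h.renewal.measurable_T n) h.levy.measurable_path
  exact ((h1 (n + 1)).sub (h1 n)).prodMk (h.renewal.measurable n)

lemma IsLevyProcess.measurable_stepProb [IsProbabilityMeasure P] (hY : IsLevyProcess Y P)
    {B : Set (ℝ × ℝ≥0)} (hB : MeasurableSet B) : Measurable (stepProb Y P B) := by
  have hA : Measurable (fun p : ℝ≥0 × (ℝ≥0 → ℝ) =>
      (pathEval p.1 p.2 - pathEval 0 p.2, p.1)) := by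
    have h0 : Measurable (fun p : ℝ≥0 × (ℝ≥0 → ℝ) => pathEval 0 p.2) :=
      measurable_pathEval_comp measurable_const measurable_snd
    exact (measurable_pathEval.sub h0).prodMk measurable_fst
  have := Measure.isProbabilityMeasure_map (μ := P) hY.measurable_path.aemeasurable
  convert measurable_measure_prodMk_left (ν := P.map fun ω t => Y t ω) (hA hB) using 1
  funext w
  rw [Measure.map_apply hY.measurable_path (measurable_prodMk_left (hA hB)), stepProb]
  refine measure_congr ?_
  filter_upwards [hY.ae_pathEval] with ω hω
  refine propext ?_
  change (Y w ω - Y 0 ω, w) ∈ B ↔ (pathEval w (Y · ω) - pathEval 0 (Y · ω), w) ∈ B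
  rw [hω, hω]

/-- With the durations frozen at deterministic values, this is independence and stationarity of the
increments of `Y`. -/
lemma IsLevyProcess.measure_iInter_increments (hY : IsLevyProcess Y P) (w : ℕ → ℝ≥0)
    (s : Finset ℕ) {B : ℕ → Set (ℝ × ℝ≥0)} (hB : ∀ i, MeasurableSet (B i)) :
    P {ω | ∀ i ∈ s, (Y (∑ k ∈ Finset.range (i + 1), w k) ω - Y (∑ k ∈ Finset.range i, w k) ω,
      w i) ∈ B i} = ∏ i ∈ s, stepProb Y P (B i) (w i) := by
  have hmono : Monotone fun i => ∑ k ∈ Finset.range i, w k :=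
    monotone_nat_of_le_succ fun n => by simp [Finset.sum_range_succ]
  have hind := iIndepFun_iff_measure_inter_preimage_eq_mul.1 (hY.indep_increments.nat hmono) s
    (sets := fun i => {z | (z, w i) ∈ B i}) fun i _ => measurable_prodMk_right (hB i)
  have hset : {ω | ∀ i ∈ s, (Y (∑ k ∈ Finset.range (i + 1), w k) ω -
      Y (∑ k ∈ Finset.range i, w k) ω, w i) ∈ B i} = ⋂ i ∈ s, (fun ω =>
        Y (∑ k ∈ Finset.range (i + 1), w k) ω - Y (∑ k ∈ Finset.range i, w k) ω) ⁻¹'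
          {z | (z, w i) ∈ B i} := by
    ext; simp
  rw [hset, hind]
  refine Finset.prod_congr rfl fun i _ => ?_
  rw [Finset.sum_range_succ]
  exact (hY.stationary_increments _ (w i)).measure_mem_eq (measurable_prodMk_right (hB i))

/-- The joint law of `W` and `Y` is a product, so `W` may be frozen. The conditional probability is
then a product of functions of the individual `W i`, and independence of the durations factors its
expectation. -/
lemma IsLevyArm.measure_iInter_armStep [IsProbabilityMeasure P] (h : IsLevyArm Y W P)
    (s : Finset ℕ) {B : ℕ → Set (ℝ × ℝ≥0)} (hB : ∀ i, MeasurableSet (B i)) :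
    P (⋂ i ∈ s, armStep Y W i ⁻¹' B i) = ∏ i ∈ s, ∫⁻ ω, stepProb Y P (B i) (W 0 ω) ∂P := by
  have hYm := h.levy.measurable_path
  have hWm : Measurable (fun ω n => W n ω) := measurable_pi_lambda _ h.renewal.measurable
  set A : Set ((ℕ → ℝ≥0) × (ℝ≥0 → ℝ)) := {p | ∀ i ∈ s,
    (pathEval (∑ k ∈ Finset.range (i + 1), p.1 k) p.2 -
      pathEval (∑ k ∈ Finset.range i, p.1 k) p.2, p.1 i) ∈ B i} with hA
  have hAm : MeasurableSet A := by
    have h1 : ∀ i : ℕ, Measurable (fun p : (ℕ → ℝ≥0) × (ℝ≥0 → ℝ) =>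
        pathEval (∑ k ∈ Finset.range i, p.1 k) p.2) := fun i =>
      measurable_pathEval_comp (by fun_prop) measurable_snd
    have h2 : A = ⋂ i ∈ s, (fun p : (ℕ → ℝ≥0) × (ℝ≥0 → ℝ) =>
        (pathEval (∑ k ∈ Finset.range (i + 1), p.1 k) p.2 -
          pathEval (∑ k ∈ Finset.range i, p.1 k) p.2, p.1 i)) ⁻¹' B i := by
      ext; simp [hA]
    rw [h2]
    refine Finset.measurableSet_biInter _ fun i _ => ?_
    have h3 : Measurable (fun p : (ℕ → ℝ≥0) × (ℝ≥0 → ℝ) => p.1 i) := by fun_prop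
    exact (((h1 (i + 1)).sub (h1 i)).prodMk h3) (hB i)
  have hlaw := (indepFun_iff_map_prod_eq_prod_map_map hWm.aemeasurable hYm.aemeasurable).1
    h.indep.symm
  have := Measure.isProbabilityMeasure_map (μ := P) hYm.aemeasurable
  have e1 : (⋂ i ∈ s, armStep Y W i ⁻¹' B i) = (fun ω => ((W · ω), (Y · ω))) ⁻¹' A := by
    ext ω; simp [hA, armStep, T]
  rw [e1, ← Measure.map_apply (hWm.prodMk hYm) hAm, hlaw, Measure.prod_apply hAm,
    lintegral_map (measurable_measure_prodMk_left hAm) hWm]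
  have e2 : ∀ ω, (P.map fun ω t => Y t ω) (Prod.mk (W · ω) ⁻¹' A) =
      ∏ i ∈ s, stepProb Y P (B i) (W i ω) := by
    intro ω
    rw [Measure.map_apply hYm (measurable_prodMk_left hAm),
      ← h.levy.measure_iInter_increments (W · ω) s hB]
    refine measure_congr ?_
    filter_upwards [h.levy.ae_pathEval] with ω' hω'
    refine propext ?_
    change (∀ i ∈ s, (pathEval (∑ k ∈ Finset.range (i + 1), W k ω) (Y · ω') -
      pathEval (∑ k ∈ Finset.range i, W k ω) (Y · ω'), W i ω) ∈ B i) ↔ _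
    simp only [hω']
    rfl
  simp only [e2]
  have hb : ∀ i, Measurable (stepProb Y P (B i)) := fun i => h.levy.measurable_stepProb (hB i)
  rw [lintegral_prod_eq_prod_lintegral_of_indepFun s (fun i ω => stepProb Y P (B i) (W i ω))
    (h.renewal.indep.comp _ hb) fun i => (hb i).comp (h.renewal.measurable i)]
  exact Finset.prod_congr rfl fun i _ => ((h.renewal.identDistrib i).comp (hb i)).lintegral_eq

lemma IsLevyArm.measure_armStep [IsProbabilityMeasure P] (h : IsLevyArm Y W P) (i : ℕ)
    {B : Set (ℝ × ℝ≥0)} (hB : MeasurableSet B) :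
    P (armStep Y W i ⁻¹' B) = ∫⁻ ω, stepProb Y P B (W 0 ω) ∂P := by
  simpa using h.measure_iInter_armStep {i} (B := fun _ => B) fun _ => hB

/-- The steps of a Lévy arm are i.i.d. -/
theorem IsLevyArm.isIIDSteps [IsProbabilityMeasure P] (h : IsLevyArm Y W P) :
    IsIIDSteps (armStep Y W) P where
  measurable := h.measurable_armStep
  indep := by
    classical
    rw [iIndepFun_iff_measure_inter_preimage_eq_mul]
    intro s B hB
    -- Only the sets indexed by `s` are known to be measurable; the others are replaced by `univ`.
    have hB' : ∀ i, MeasurableSet (if i ∈ s then B i else univ) := fun i => by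
      split_ifs with hi
      · exact hB i hi
      · exact MeasurableSet.univ
    have h1 := h.measure_iInter_armStep s hB'
    have h2 : (⋂ i ∈ s, armStep Y W i ⁻¹' (if i ∈ s then B i else univ)) =
        ⋂ i ∈ s, armStep Y W i ⁻¹' B i :=
      iInter₂_congr fun i hi => by rw [if_pos hi]
    rw [← h2, h1]
    exact Finset.prod_congr rfl fun i hi => by
      rw [if_pos hi, h.measure_armStep i (hB i hi)]
  identDistrib n :=
    ⟨(h.measurable_armStep n).aemeasurable, (h.measurable_armStep 0).aemeasurable, by
      refine Measure.ext fun B hB => ?_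
      rw [Measure.map_apply (h.measurable_armStep n) hB,
        Measure.map_apply (h.measurable_armStep 0) hB, h.measure_armStep n hB,
        h.measure_armStep 0 hB]⟩
  pos := h.renewal.pos 0

omit [MeasurableSpace Ω] in
lemma clock_armStep (n : ℕ) (ω : Ω) : clock (armStep Y W · ω) n = T W n ω := rfl

/-- The increments telescope; right-continuity identifies `pathEval` with evaluation, and the path
starts at 0. -/
lemma IsLevyArm.ae_walk_eq (h : IsLevyArm Y W P) :
    ∀ᵐ ω ∂P, ∀ n, S Y W n ω = walk (armStep Y W · ω) n := by
  filter_upwards [h.levy.ae_pathEval, h.levy.start_zero] with ω h1 h2 n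
  have h3 : walk (armStep Y W · ω) n = pathEval (T W n ω) (Y · ω) - pathEval (T W 0 ω) (Y · ω) :=
    Finset.sum_range_sub (fun n => pathEval (T W n ω) (Y · ω)) n
  rw [h3, h1, h1]
  simp [S, T, h2]

end

/-! ### Occupation sums, the measure `μ` and discounted ratios. -/

section

variable {Ω : Type*} [MeasurableSpace Ω]

/-- `E[exp (-q T_n) f(S_n); D]` for vector-valued `f`. -/
def occIntegral {E : Type*} [NormedAddCommGroup E] [NormedSpace ℝ E] (X : ℕ → Ω → ℝ × ℝ≥0)
    (P : Measure Ω) (q : ℝ) (D : Set Ω) (n : ℕ) (f : ℝ → E) : E :=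
  ∫ ω in D, Real.exp (-q * (clock (X · ω) n : ℝ)) • f (walk (X · ω) n) ∂P

section Steps

variable {E : Type*} [NormedAddCommGroup E] [NormedSpace ℝ E] {X : ℕ → Ω → ℝ × ℝ≥0}
  {P : Measure Ω} {q : ℝ} {D : Set Ω} {n : ℕ}

lemma enorm_discount_smul (x : ℕ → ℝ × ℝ≥0) (n : ℕ) (v : E) :
    ‖Real.exp (-q * (clock x n : ℝ)) • v‖ₑ = discount q x n * ‖v‖ₑ := by
  rw [enorm_smul, discount, Real.enorm_of_nonneg (Real.exp_nonneg _)]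

lemma stronglyMeasurable_occIntegrand (hX : ∀ n, Measurable (X n)) (n : ℕ) {f : ℝ → E}
    (hf : StronglyMeasurable f) :
    StronglyMeasurable fun ω => Real.exp (-q * (clock (X · ω) n : ℝ)) • f (walk (X · ω) n) := by
  have h1 : Measurable fun ω => clock (X · ω) n := (measurable_clock n).comp (measurable_steps hX)
  have h2 : Measurable fun ω => walk (X · ω) n := (measurable_walk n).comp (measurable_steps hX)
  have h3 : Measurable fun ω => Real.exp (-q * (clock (X · ω) n : ℝ)) := by fun_prop
  exact h3.stronglyMeasurable.smul (hf.comp_measurable h2)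

lemma integrableOn_occIntegrand (hX : ∀ n, Measurable (X n)) {f : ℝ → E}
    (hf : StronglyMeasurable f) (h : occ X P q D n (fun y => ‖f y‖ₑ) ≠ ∞) :
    IntegrableOn (fun ω => Real.exp (-q * (clock (X · ω) n : ℝ)) • f (walk (X · ω) n)) D P := by
  refine ⟨(stronglyMeasurable_occIntegrand hX n hf).aestronglyMeasurable, ?_⟩
  rw [hasFiniteIntegral_iff_enorm]
  simp only [enorm_discount_smul]
  exact lt_top_iff_ne_top.2 h

lemma integral_norm_occIntegrand (hX : ∀ n, Measurable (X n)) {f : ℝ → E}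
    (hf : StronglyMeasurable f) :
    ∫ ω in D, ‖Real.exp (-q * (clock (X · ω) n : ℝ)) • f (walk (X · ω) n)‖ ∂P =
      (occ X P q D n (fun y => ‖f y‖ₑ)).toReal := by
  rw [integral_norm_eq_lintegral_enorm
    (stronglyMeasurable_occIntegrand hX n hf).aestronglyMeasurable]
  simp only [enorm_discount_smul]
  rfl

lemma summable_norm_occIntegral (hX : ∀ n, Measurable (X n)) {D : ℕ → Set Ω} {f : ℝ → E}
    (hf : StronglyMeasurable f) (h : ∑' n, occ X P q (D n) n (fun y => ‖f y‖ₑ) ≠ ∞) :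
    Summable fun n => ‖occIntegral X P q (D n) n f‖ :=
  (ENNReal.summable_toReal h).of_nonneg_of_le (fun _ => norm_nonneg _) fun _ =>
    (norm_integral_le_integral_norm _).trans_eq (integral_norm_occIntegrand hX hf)

/-- Bridge between the signed sums of the statement and the `ℝ≥0∞`-valued sums of the optimal
stopping argument. -/
lemma tsum_occIntegral_eq_sub (hX : ∀ n, Measurable (X n)) {D : ℕ → Set Ω} {f : ℝ → ℝ}
    (hf : Measurable f) (h : ∑' k, occ X P q (D k) k (fun y => ‖f y‖ₑ) ≠ ∞) :
    ∑' n, occIntegral X P q (D n) n f =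
      (∑' n, occ X P q (D n) n (fun y => ENNReal.ofReal (f y))).toReal -
        (∑' n, occ X P q (D n) n (fun y => ENNReal.ofReal (-f y))).toReal := by
  have hle : ∀ g : ℝ → ℝ≥0∞, (∀ y, g y ≤ ‖f y‖ₑ) → ∑' k, occ X P q (D k) k g ≠ ∞ := fun g hg =>
    ((ENNReal.tsum_le_tsum fun _ => occ_mono _ _ hg).trans_lt (lt_top_iff_ne_top.2 h)).ne
  have h1 := hle (fun y => ENNReal.ofReal (f y)) fun y => Real.ofReal_le_enorm _
  have h2 := hle (fun y => ENNReal.ofReal (-f y)) fun y => by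
    simpa using Real.ofReal_le_enorm (-f y)
  rw [ENNReal.tsum_toReal_eq (ENNReal.ne_top_of_tsum_ne_top h1),
    ENNReal.tsum_toReal_eq (ENNReal.ne_top_of_tsum_ne_top h2),
    ← (ENNReal.summable_toReal h1).tsum_sub (ENNReal.summable_toReal h2)]
  refine tsum_congr fun n => ?_
  rw [occIntegral, integral_eq_lintegral_pos_part_sub_lintegral_neg_part
    (integrableOn_occIntegrand hX hf.stronglyMeasurable (ENNReal.ne_top_of_tsum_ne_top h n))]
  simp only [occ, discount, smul_eq_mul, ← mul_neg, ENNReal.ofReal_mul (Real.exp_nonneg _)]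

variable [IsProbabilityMeasure P]

lemma IsIIDSteps.tsum_occ_const_ne_top (hX : IsIIDSteps X P) (hq : 0 < q) (D : ℕ → Set Ω)
    {c : ℝ≥0∞} (hc : c ≠ ∞) : ∑' n, occ X P q (D n) n (fun _ => c) ≠ ∞ := by
  refine ((ENNReal.tsum_le_tsum fun n =>
    (occ_mono_set (subset_univ (D n)).eventuallyLE n _)).trans_lt ?_).ne
  simp only [hX.occ_univ_const]
  rw [ENNReal.tsum_mul_left, ENNReal.tsum_geometric]
  refine ENNReal.mul_lt_top (lt_top_iff_ne_top.2 hc) (ENNReal.inv_lt_top.2 ?_)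
  exact tsub_pos_iff_lt.2 (hX.stepDiscount_lt_one hq)

/-- The discounted count of the time spent before stopping is positive. -/
lemma IsIIDSteps.tsum_occIntegral_one_pos (hX : IsIIDSteps X P) (hq : 0 < q) {D : ℕ → Set Ω}
    (hD : D 0 =ᵐ[P] univ) : 0 < ∑' n, occIntegral X P q (D n) n (fun _ => (1 : ℝ)) := by
  have hs := (summable_norm_occIntegral (f := fun _ => (1 : ℝ)) (P := P) (q := q) (D := D)
    hX.measurable stronglyMeasurable_const
    (hX.tsum_occ_const_ne_top hq D (by simp))).of_norm
  refine hs.tsum_pos (fun n => ?_) 0 ?_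
  · exact setIntegral_nonneg_of_ae (ae_of_all _ fun ω => by simp [Real.exp_nonneg])
  · rw [occIntegral, setIntegral_congr_set hD]
    simp

end Steps

section Arm

variable {E : Type*} [NormedAddCommGroup E] [NormedSpace ℝ E] {Y : ℝ≥0 → Ω → ℝ}
  {W : ℕ → Ω → ℝ≥0} {P : Measure Ω} {q : ℝ}

omit [MeasurableSpace Ω] in
lemma hittingAfter_one_le_iff {u : ℕ → Ω → ℝ} {A : Set ℝ} {n : ℕ} {ω : Ω} :
    hittingAfter u A 1 ω ≤ (n : WithTop ℕ) ↔ ∃ j ∈ Icc 1 n, u j ω ∈ A :=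
  hittingAfter_le_iff

lemma IsLevyArm.ae_lt_Nhat_iff (h : IsLevyArm Y W P) :
    ∀ᵐ ω ∂P, ∀ n : ℕ, (n : WithTop ℕ) < Nhat Y W ω ↔ ω ∈ stay (armStep Y W) n := by
  filter_upwards [h.ae_walk_eq] with ω hω n
  rw [← not_le, Nhat, hittingAfter_one_le_iff]
  simp [stay, hω]

lemma IsLevyArm.stay_ae_eq (h : IsLevyArm Y W P) (n : ℕ) :
    stay (armStep Y W) n =ᵐ[P] {ω | (n : WithTop ℕ) < Nhat Y W ω} := by
  filter_upwards [h.ae_lt_Nhat_iff] with ω hω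
  exact propext (hω n).symm

lemma IsLevyArm.occupation_eq (h : IsLevyArm Y W P) :
    occupation Y W P q = Measure.sum fun k => ((P.restrict (stay (armStep Y W) k)).withDensity
      fun ω => discount q (armStep Y W · ω) k).map fun ω => walk (armStep Y W · ω) k := by
  unfold occupation
  congr 1
  funext k
  rw [← Measure.restrict_congr_set (h.stay_ae_eq k)]
  refine Measure.map_congr ?_
  have h1 : ∀ᵐ ω ∂P, S Y W k ω = walk (armStep Y W · ω) k := h.ae_walk_eq.mono fun ω hω => hω k
  exact (withDensity_absolutelyContinuous _ _).ae_le (ae_restrict_of_ae h1)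

variable [IsProbabilityMeasure P]

omit [IsProbabilityMeasure P] in
lemma IsLevyArm.measurable_walk_armStep (h : IsLevyArm Y W P) (k : ℕ) :
    Measurable fun ω => walk (armStep Y W · ω) k :=
  (measurable_walk k).comp (measurable_steps h.measurable_armStep)

omit [IsProbabilityMeasure P] in
lemma IsLevyArm.measurable_discount_armStep (h : IsLevyArm Y W P) (k : ℕ) :
    Measurable fun ω => discount q (armStep Y W · ω) k :=
  (measurable_discount q k).comp (measurable_steps h.measurable_armStep)

omit [IsProbabilityMeasure P] in
lemma IsLevyArm.lintegral_occupation (h : IsLevyArm Y W P) {g : ℝ → ℝ≥0∞} (hg : Measurable g) :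
    ∫⁻ y, g y ∂(occupation Y W P q) = ∑' k, occ (armStep Y W) P q (stay (armStep Y W) k) k g := by
  rw [h.occupation_eq, lintegral_sum_measure]
  refine tsum_congr fun k => ?_
  rw [lintegral_map hg (h.measurable_walk_armStep k), lintegral_withDensity_eq_lintegral_mul _
    (h.measurable_discount_armStep k) (g := fun ω => g (walk (armStep Y W · ω) k))
    (hg.comp (h.measurable_walk_armStep k))]
  rfl

omit [IsProbabilityMeasure P] in
lemma IsLevyArm.integral_occupation (h : IsLevyArm Y W P) {f : ℝ → E}
    (hf : StronglyMeasurable f) (hfi : Integrable f (occupation Y W P q)) :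
    ∫ y, f y ∂(occupation Y W P q) =
      ∑' k, occIntegral (armStep Y W) P q (stay (armStep Y W) k) k f := by
  rw [h.occupation_eq] at hfi ⊢
  rw [integral_sum_measure hfi]
  refine tsum_congr fun k => ?_
  rw [integral_map (h.measurable_walk_armStep k).aemeasurable hf.aestronglyMeasurable,
    integral_withDensity_eq_integral_toReal_smul (h.measurable_discount_armStep k)
      (ae_of_all _ fun ω => ENNReal.ofReal_lt_top)]
  simp [discount, ENNReal.toReal_ofReal (Real.exp_nonneg _), occIntegral]

lemma IsLevyArm.one_le_occupation_univ (h : IsLevyArm Y W P) :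
    1 ≤ occupation Y W P q univ := by
  have := h.lintegral_occupation (q := q) (g := fun _ => 1) measurable_const
  rw [lintegral_one] at this
  rw [this]
  refine le_trans ?_ (ENNReal.le_tsum 0)
  simp [occ, stay_zero]

lemma IsLevyArm.occupation_univ_ne_top (h : IsLevyArm Y W P) (hq : 0 < q) :
    occupation Y W P q univ ≠ ∞ := by
  have := h.lintegral_occupation (q := q) (g := fun _ => 1) measurable_const
  rw [lintegral_one] at this
  rw [this]
  exact h.isIIDSteps.tsum_occ_const_ne_top hq _ ENNReal.one_ne_top

lemma IsLevyArm.isProbabilityMeasure_mu (h : IsLevyArm Y W P) (hq : 0 < q) :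
    IsProbabilityMeasure (mu Y W P q) :=
  ⟨by
    rw [mu, Measure.smul_apply, smul_eq_mul]
    exact ENNReal.inv_mul_cancel (one_pos.trans_le h.one_le_occupation_univ).ne'
      (h.occupation_univ_ne_top hq)⟩

omit [IsProbabilityMeasure P] in
lemma IsLevyArm.mu_Iio_zero (h : IsLevyArm Y W P) : mu Y W P q (Iio 0) = 0 := by
  have h1 : occupation Y W P q (Iio 0) = 0 := by
    rw [← lintegral_indicator_one measurableSet_Iio,
      h.lintegral_occupation (measurable_one.indicator measurableSet_Iio),
      ENNReal.tsum_eq_zero]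
    intro k
    refine (setLIntegral_congr_fun (past_le h.measurable_armStep k _
      (measurableSet_past_stay le_rfl)) (g := fun _ => 0) fun ω hω => ?_).trans (by simp)
    have := walk_nonneg_of_mem_stay hω
    simp [this]
  rw [mu, Measure.smul_apply, h1, smul_zero]

omit [IsProbabilityMeasure P] in
lemma IsLevyArm.restrict_mu (h : IsLevyArm Y W P) :
    (mu Y W P q).restrict (Ici 0) = mu Y W P q := by
  refine Measure.restrict_eq_self_of_ae_mem ?_
  rw [ae_iff]
  convert h.mu_Iio_zero (q := q) using 2
  ext; simp

omit [NormedSpace ℝ E] in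
lemma IsLevyArm.integrable_mu_iff (h : IsLevyArm Y W P) (hq : 0 < q) {f : ℝ → E}
    (hf : StronglyMeasurable f) : Integrable f (mu Y W P q) ↔
      ∑' k, occ (armStep Y W) P q (stay (armStep Y W) k) k (fun y => ‖f y‖ₑ) ≠ ∞ := by
  have h1 := (one_pos.trans_le (h.one_le_occupation_univ (q := q))).ne'
  rw [mu, integrable_smul_measure (ENNReal.inv_ne_zero.2 (h.occupation_univ_ne_top hq))
    (ENNReal.inv_ne_top.2 h1), ← h.lintegral_occupation hf.enorm]
  refine ⟨fun hi => hi.2.ne, fun hi => ⟨hf.aestronglyMeasurable, lt_top_iff_ne_top.2 hi⟩⟩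

lemma IsLevyArm.integral_mu (h : IsLevyArm Y W P) (hq : 0 < q) {f : ℝ → E}
    (hf : StronglyMeasurable f) (hfi : Integrable f (mu Y W P q)) :
    ∫ y, f y ∂(mu Y W P q) = (occupation Y W P q univ)⁻¹.toReal •
      ∑' k, occIntegral (armStep Y W) P q (stay (armStep Y W) k) k f := by
  have h1 := (one_pos.trans_le (h.one_le_occupation_univ (q := q))).ne'
  rw [mu, integrable_smul_measure (ENNReal.inv_ne_zero.2 (h.occupation_univ_ne_top hq))
    (ENNReal.inv_ne_top.2 h1)] at hfi
  rw [mu, integral_smul_measure, h.integral_occupation hf hfi]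

omit [IsProbabilityMeasure P] in
-- Sum and expectation are interchanged by absolute summability. The sets `D k` are measurable
-- versions of `{k < τ}`, needed because stopping times of a completed filtration may fail to be
-- measurable.
lemma IsLevyArm.integral_discountedSum (h : IsLevyArm Y W P) {f : ℝ → ℝ} (hf : Measurable f)
    {τ : Ω → WithTop ℕ} {D : ℕ → Set Ω} (hD : ∀ k, MeasurableSet (D k))
    (hτ : ∀ k : ℕ, D k =ᵐ[P] {ω | (k : WithTop ℕ) < τ ω})
    (hfin : ∑' k, occ (armStep Y W) P q (D k) k (fun y => ‖f y‖ₑ) ≠ ∞) :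
    ∫ ω, discountedSum Y W q f τ ω ∂P = ∑' k, occIntegral (armStep Y W) P q (D k) k f := by
  set F : ℕ → Ω → ℝ := fun k => (D k).indicator fun ω =>
    Real.exp (-q * (clock (armStep Y W · ω) k : ℝ)) • f (walk (armStep Y W · ω) k) with hF
  have hX := h.measurable_armStep
  have h1 : ∀ k, Integrable (F k) P := fun k =>
    (integrableOn_occIntegrand hX hf.stronglyMeasurable
      (ENNReal.ne_top_of_tsum_ne_top hfin k)).integrable_indicator (hD k)
  have h2 : Summable fun k => ∫ ω, ‖F k ω‖ ∂P := by
    refine (ENNReal.summable_toReal hfin).congr fun k => ?_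
    simp only [hF, norm_indicator_eq_indicator_norm]
    rw [integral_indicator (hD k), integral_norm_occIntegrand hX hf.stronglyMeasurable]
  have h3 := (hasSum_integral_of_summable_integral_norm h1 h2).tsum_eq
  have h4 : ∀ k, ∫ ω, F k ω ∂P = occIntegral (armStep Y W) P q (D k) k f := fun k =>
    integral_indicator (hD k)
  simp only [h4] at h3
  rw [h3]
  refine integral_congr_ae ?_
  filter_upwards [h.ae_walk_eq, ae_all_iff.2 hτ] with ω h5 h6
  refine tsum_congr fun k => ?_
  have h7 : ω ∈ D k ↔ (k : WithTop ℕ) < τ ω := iff_of_eq (h6 k)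
  by_cases h8 : ω ∈ D k
  · rw [if_pos (h7.1 h8), hF, h5]
    simp [h8, clock_armStep]
  · rw [if_neg (mt h7.2 h8), hF]
    simp [h8]

lemma IsLevyArm.discountedRatio_eq (h : IsLevyArm Y W P) (hq : 0 < q) {f : ℝ → ℝ}
    (hf : Measurable f) {τ : Ω → WithTop ℕ} {D : ℕ → Set Ω} (hD : ∀ k, MeasurableSet (D k))
    (hτ : ∀ k : ℕ, D k =ᵐ[P] {ω | (k : WithTop ℕ) < τ ω})
    (hfin : ∑' k, occ (armStep Y W) P q (D k) k (fun y => ‖f y‖ₑ) ≠ ∞) :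
    discountedRatio Y W P q f τ = (∑' k, occIntegral (armStep Y W) P q (D k) k f) /
      ∑' k, occIntegral (armStep Y W) P q (D k) k (fun _ => (1 : ℝ)) := by
  rw [discountedRatio, h.integral_discountedSum hf hD hτ hfin,
    h.integral_discountedSum measurable_const hD hτ
      (h.isIIDSteps.tsum_occ_const_ne_top hq D (by simp))]

omit [IsProbabilityMeasure P] in
lemma IsLevyArm.measurableSet_stay (h : IsLevyArm Y W P) (k : ℕ) :
    MeasurableSet (stay (armStep Y W) k) :=
  past_le h.measurable_armStep k _ (measurableSet_past_stay le_rfl)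

/-- The normalizing constant is identified by integrating the constant 1 against the probability
measure `μ`. -/
lemma IsLevyArm.integral_mu_eq_discountedRatio (h : IsLevyArm Y W P) (hq : 0 < q) {f : ℝ → ℝ}
    (hf : Measurable f) (hfi : Integrable f (mu Y W P q)) :
    ∫ y, f y ∂(mu Y W P q) = discountedRatio Y W P q f (Nhat Y W) := by
  have := h.isProbabilityMeasure_mu hq
  have h1 := h.integral_mu hq hf.stronglyMeasurable hfi
  have h2 := h.integral_mu hq (f := fun _ => (1 : ℝ)) stronglyMeasurable_const
    (integrable_const 1)
  rw [h.discountedRatio_eq hq hf h.measurableSet_stay h.stay_ae_eq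
    ((h.integrable_mu_iff hq hf.stronglyMeasurable).1 hfi), h1]
  have h3 := h.isIIDSteps.tsum_occIntegral_one_pos (q := q) hq (D := stay (armStep Y W))
    stay_zero.eventuallyEq
  rw [eq_div_iff h3.ne', smul_eq_mul]
  simp only [integral_const, probReal_univ, smul_eq_mul, one_mul] at h2
  rw [mul_right_comm, ← h2, one_mul]

end Arm

end

/-! ### Transforms at the ladder epochs and the transform of `μ`. -/

section

variable {Ω : Type*} [MeasurableSpace Ω]

variable {Y : ℝ≥0 → Ω → ℝ} {W : ℕ → Ω → ℝ≥0} {P : Measure Ω} {q θ : ℝ}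

lemma withTop_eq_succ_iff {a : WithTop ℕ} {n : ℕ} : a = ((n + 1 : ℕ) : WithTop ℕ) ↔
    a ≤ ((n + 1 : ℕ) : WithTop ℕ) ∧ ¬ a ≤ (n : WithTop ℕ) := by
  induction a using WithTop.recTopCoe with
  | top => exact ⟨fun H => (WithTop.top_ne_coe H).elim,
      fun H => (WithTop.coe_lt_top (n + 1)).not_ge H.1 |>.elim⟩
  | coe m =>
    change (m : WithTop ℕ) = _ ↔ (m : WithTop ℕ) ≤ _ ∧ ¬ (m : WithTop ℕ) ≤ _
    norm_cast
    omega

lemma IsLevyArm.ae_N_eq_iff (h : IsLevyArm Y W P) :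
    ∀ᵐ ω ∂P, ∀ n : ℕ, N Y W ω = ((n + 1 : ℕ) : WithTop ℕ) ↔
      ω ∈ firstAscent (armStep Y W) n := by
  filter_upwards [h.ae_walk_eq] with ω hω n
  rw [withTop_eq_succ_iff, N, hittingAfter_one_le_iff, hittingAfter_one_le_iff]
  simp only [firstAscent, mem_ofPred_eq, hω, mem_Ioi, not_exists, not_and, not_lt]
  constructor
  · rintro ⟨⟨j, hj, hpos⟩, H⟩
    refine ⟨fun i hi => H i (by simpa using hi), ?_⟩
    have hjn : j = n + 1 := by
      by_contra hne
      have hj' := mem_Icc.1 hj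
      exact absurd hpos (H j (mem_Icc.2 ⟨hj'.1, by omega⟩)).not_gt
    exact hjn ▸ hpos
  · rintro ⟨H, hpos⟩
    exact ⟨⟨n + 1, mem_Icc.2 ⟨by omega, le_rfl⟩, hpos⟩, fun i hi => H i (by simpa using hi)⟩

lemma IsLevyArm.ae_Nhat_eq_iff (h : IsLevyArm Y W P) :
    ∀ᵐ ω ∂P, ∀ n : ℕ, Nhat Y W ω = ((n + 1 : ℕ) : WithTop ℕ) ↔
      ω ∈ stay (armStep Y W) n \ stay (armStep Y W) (n + 1) := by
  filter_upwards [h.ae_lt_Nhat_iff] with ω hω n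
  rw [withTop_eq_succ_iff, Set.mem_sdiff, ← hω, ← hω, not_lt, not_le, and_comm]

omit [MeasurableSpace Ω] in
lemma hittingAfter_one_pos {u : ℕ → Ω → ℝ} {A : Set ℝ} (ω : Ω) : 0 < hittingAfter u A 1 ω :=
  lt_of_lt_of_le (by norm_num) (le_hittingAfter (n := 1) ω)

/-- The expectation is split according to the value of `τ`. The value 0 is excluded, which accounts
for the index `n + 1`, and `τ = ⊤` contributes nothing. -/
lemma IsLevyArm.stoppedTransform_eq [IsProbabilityMeasure P] (h : IsLevyArm Y W P) (hq : 0 < q)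
    {τ : Ω → WithTop ℕ} {A : ℕ → Set Ω} (hA : ∀ n, MeasurableSet (A n)) (h0 : ∀ ω, 0 < τ ω)
    (hτ : ∀ᵐ ω ∂P, ∀ n : ℕ, τ ω = ((n + 1 : ℕ) : WithTop ℕ) ↔ ω ∈ A n) :
    stoppedTransform Y W P τ q θ = ∑' n, transform (armStep Y W) P q θ (A n) (n + 1) := by
  have hX := h.isIIDSteps
  set F : ℕ → Ω → ℂ := fun n => (A n).indicator fun ω => waveExp q θ (armStep Y W · ω) (n + 1)
    with hF
  have h1 : ∀ n, Integrable (F n) P := fun n =>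
    (integrable_waveExp hX.measurable hq (n + 1)).indicator (hA n)
  have h2 : Summable fun n => ∫ ω, ‖F n ω‖ ∂P := by
    refine ((summable_nat_add_iff 1).2 (hX.summable_geometric hq)).of_nonneg_of_le
      (fun n => integral_nonneg fun _ => norm_nonneg _) fun n => ?_
    rw [← hX.integral_norm_waveExp (θ := θ)]
    exact integral_mono (h1 n).norm (integrable_waveExp hX.measurable hq (n + 1)).norm
      fun ω => norm_indicator_le_norm_self _ _
  have h3 := (hasSum_integral_of_summable_integral_norm h1 h2).tsum_eq
  have h4 : ∀ n, ∫ ω, F n ω ∂P = transform (armStep Y W) P q θ (A n) (n + 1) := fun n =>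
    integral_indicator (hA n)
  simp only [h4] at h3
  rw [h3, stoppedTransform]
  refine integral_congr_ae ?_
  filter_upwards [h.ae_walk_eq, hτ] with ω h5 h6
  rcases hm : τ ω with _ | m
  · have : ∀ n, F n ω = 0 := fun n => by
      rw [hF]
      refine indicator_of_notMem (fun hn => ?_) _
      rw [← h6, hm] at hn
      exact WithTop.top_ne_coe hn
    simp [this]
  · obtain ⟨k, rfl⟩ : ∃ k, m = k + 1 := by
      refine Nat.exists_eq_succ_of_ne_zero fun h0' => ?_
      have := h0 ω
      rw [hm, h0'] at this
      exact lt_irrefl _ this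
    have hk : ω ∈ A k := (h6 k).1 hm
    rw [tsum_eq_single k]
    · simp only [hF, indicator_of_mem hk, waveExp, h5]
      rfl
    · intro n hn
      rw [hF]
      refine indicator_of_notMem (fun hn' => hn ?_) _
      rw [← h6, hm] at hn'
      have : k + 1 = n + 1 := WithTop.coe_injective hn'
      omega

section Transforms

variable [IsProbabilityMeasure P]

omit [IsProbabilityMeasure P] in
lemma IsLevyArm.kappa_eq (h : IsLevyArm Y W P) :
    kappa Y W P q θ = transform (armStep Y W) P q θ univ 1 := by
  rw [transform, Measure.restrict_univ, kappa]
  refine integral_congr_ae ?_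
  filter_upwards [h.ae_walk_eq] with ω hω
  rw [waveExp, hω, clock_armStep]

lemma IsLevyArm.phi_eq (h : IsLevyArm Y W P) (hq : 0 < q) : phi Y W P q θ =
    ∑' n, transform (armStep Y W) P q θ (firstAscent (armStep Y W) n) (n + 1) :=
  h.stoppedTransform_eq hq
    (fun n => past_le h.measurable_armStep _ _ (measurableSet_past_firstAscent n))
    hittingAfter_one_pos h.ae_N_eq_iff

lemma IsLevyArm.phihat_eq (h : IsLevyArm Y W P) (hq : 0 < q) : phihat Y W P q θ =
    ∑' n, transform (armStep Y W) P q θ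
      (stay (armStep Y W) n \ stay (armStep Y W) (n + 1)) (n + 1) :=
  h.stoppedTransform_eq hq
    (fun n => (h.measurableSet_stay n).diff (h.measurableSet_stay (n + 1)))
    hittingAfter_one_pos h.ae_Nhat_eq_iff

lemma IsLevyArm.one_sub_phi_mul (h : IsLevyArm Y W P) (hq : 0 < q) :
    (1 - phi Y W P q θ) * occTransform (armStep Y W) P q θ = 1 := by
  rw [h.phi_eq hq, h.isIIDSteps.one_sub_ascending_mul hq]

lemma IsLevyArm.one_sub_phihat (h : IsLevyArm Y W P) (hq : 0 < q) : 1 - phihat Y W P q θ =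
    (1 - kappa Y W P q θ) * occTransform (armStep Y W) P q θ := by
  rw [h.phihat_eq hq, h.kappa_eq, h.isIIDSteps.one_sub_descending hq]

/-- The modulus of `κ` is at most the mean one-step discount, which is below 1. -/
lemma IsLevyArm.one_sub_kappa_ne_zero (h : IsLevyArm Y W P) (hq : 0 < q) :
    1 - kappa Y W P q θ ≠ 0 := by
  intro h0
  have hX := h.isIIDSteps
  have h1 := hX.norm_transform_le (θ := θ) hq univ 1
  have h2 := hX.stepDiscount_lt_one hq
  have h3 : (stepDiscount (armStep Y W) P q).toReal < 1 := by
    simpa using (ENNReal.toReal_lt_toReal (h2.trans_le le_top).ne ENNReal.one_ne_top).2 h2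
  rw [← h.kappa_eq, ← sub_eq_zero.1 h0, norm_one, pow_one] at h1
  linarith

lemma IsLevyArm.integral_exp_mu (h : IsLevyArm Y W P) (hq : 0 < q) (θ : ℝ) :
    ∫ y, Complex.exp (Complex.I * θ * (y : ℝ)) ∂(mu Y W P q) =
      (occupation Y W P q univ)⁻¹.toReal • occTransform (armStep Y W) P q θ := by
  have := h.isProbabilityMeasure_mu hq
  have hm : Measurable fun y : ℝ => Complex.exp (Complex.I * θ * (y : ℝ)) := by fun_prop
  rw [h.integral_mu hq hm.stronglyMeasurable, occTransform]
  · congr 1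
    refine tsum_congr fun k => ?_
    rw [occIntegral, transform]
    congr 1
    funext ω
    rw [waveExp, Complex.exp_add, Complex.real_smul]
    push_cast
    rfl
  · refine Integrable.of_bound hm.aestronglyMeasurable 1 (ae_of_all _ fun y => ?_)
    simp [Complex.norm_exp]

theorem IsLevyArm.integral_exp_mu_eq_div (h : IsLevyArm Y W P) (hq : 0 < q) (θ : ℝ) :
    ∫ y, Complex.exp (Complex.I * θ * (y : ℝ)) ∂(mu Y W P q) =
      occTransform (armStep Y W) P q θ / occTransform (armStep Y W) P q 0 := by
  have := h.isProbabilityMeasure_mu hq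
  have h0 := h.integral_exp_mu hq 0
  simp only [Complex.ofReal_zero, mul_zero, zero_mul, Complex.exp_zero, integral_const,
    probReal_univ, one_smul, Complex.real_smul] at h0
  rw [h.integral_exp_mu hq, eq_div_iff (right_ne_zero_of_mul (h.one_sub_phi_mul hq ▸ one_ne_zero)),
    Complex.real_smul, mul_right_comm, ← h0, one_mul]

end Transforms

/-! ### The Gittins index. -/

section Gittins

/-- `S_i` agrees almost surely with the walk after `i` steps, so the completion absorbs the
difference. -/
lemma IsLevyArm.armFiltration_le (h : IsLevyArm Y W P) (n : ℕ) :
    armFiltration Y W P n ≤ eventuallyMeasurableSpace (past (armStep Y W) n) (ae P) := by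
  have h1 : ((⨆ i ∈ Finset.range (n + 1), (inferInstance : MeasurableSpace ℝ).comap (S Y W i)) ⊔
      (⨆ i ∈ Finset.range n, (inferInstance : MeasurableSpace ℝ≥0).comap (W i))) ≤
        eventuallyMeasurableSpace (past (armStep Y W) n) (ae P) := by
    refine sup_le (iSup₂_le fun i hi => ?_) (iSup₂_le fun i hi => ?_)
    · have h2 : S Y W i =ᵐ[P] fun ω => walk (armStep Y W · ω) i :=
        h.ae_walk_eq.mono fun ω hω => hω i
      exact Measurable.comap_le (Measurable.eventuallyMeasurable_of_eventuallyEq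
        (measurable_past_walk (Nat.lt_succ_iff.1 (Finset.mem_range.1 hi))) h2)
    · refine le_trans (Measurable.comap_le ?_) le_eventuallyMeasurableSpace
      exact measurable_snd.comp
        (measurable_past_step (X := armStep Y W) (Finset.mem_range.1 hi))
  rintro s ⟨t, ht, hst⟩
  obtain ⟨u, hu, htu⟩ := h1 t ht
  exact ⟨u, hu, hst.trans htu⟩

lemma IsLevyArm.exists_past_ae_eq (h : IsLevyArm Y W P) {τ : Ω → WithTop ℕ}
    (hτ : IsStoppingTime (armFiltration Y W P) τ) (k : ℕ) :
    ∃ D, MeasurableSet[past (armStep Y W) k] D ∧ D =ᵐ[P] {ω | (k : WithTop ℕ) < τ ω} := by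
  have h1 : MeasurableSet[armFiltration Y W P k] {ω | (k : WithTop ℕ) < τ ω} := by
    have := (hτ k).compl
    convert this using 1
    ext ω
    simp only [mem_compl_iff, mem_ofPred_eq, not_le]
    rfl
  obtain ⟨D, hD, h2⟩ := h.armFiltration_le k _ h1
  exact ⟨D, hD, h2.symm⟩

lemma isStoppingTime_Nhat : IsStoppingTime (armFiltration Y W P) (Nhat Y W) := by
  intro n
  refine (le_eventuallyMeasurableSpace (l := ae P)) _ ?_
  have h1 : {ω | Nhat Y W ω ≤ (n : WithTop ℕ)} = ⋃ j ∈ Icc 1 n, S Y W j ⁻¹' Iic 0 := by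
    ext ω
    simp only [Nhat, mem_ofPred_eq, hittingAfter_one_le_iff, mem_iUnion, exists_prop]
    rfl
  refine h1 ▸ MeasurableSet.biUnion (to_countable _) fun j hj => ?_
  refine le_sup_left (a := ⨆ i ∈ Finset.range (n + 1), MeasurableSpace.comap (S Y W i) _) _ ?_
  exact le_biSup (fun i => (inferInstance : MeasurableSpace ℝ).comap (S Y W i))
    (Finset.mem_range.2 (Nat.lt_succ_iff.2 hj.2)) _ ⟨_, measurableSet_Iic, rfl⟩

variable [IsProbabilityMeasure P] {R : ℝ → ℝ} {x : ℝ}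

lemma integral_exp_neg_mul (hq : q ≠ 0) (a b : ℝ) :
    ∫ r in a..b, Real.exp (-q * r) = (Real.exp (-q * a) - Real.exp (-q * b)) / q := by
  rw [intervalIntegral.integral_comp_mul_left _ (neg_ne_zero.2 hq), integral_exp, smul_eq_mul]
  field_simp
  ring

/-- The integral over the `s`-th renewal interval is `e^{-q T_s} (1 - e^{-q W_s}) / q`. As `W_s` is
independent of the past, its factor has the same mean for every `s`, and this mean is nonzero, so it
can be divided out. -/
lemma IsLevyArm.tsum_occ_ne_top (h : IsLevyArm Y W P) (hq : 0 < q) (hR : Monotone R)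
    (hint : RewardIntegrable Y W P q R x) :
    ∑' k, occ (armStep Y W) P q univ k (fun y => ‖R (x + y)‖ₑ) ≠ ∞ := by
  have hX := h.isIIDSteps
  have hRm := hR.measurable
  set g : ℝ × ℝ≥0 → ℝ≥0∞ := fun p => ENNReal.ofReal ((1 - Real.exp (-q * (p.2 : ℝ))) / q) with hg
  have hgm : Measurable g := by fun_prop
  have hterm : ∀ k, Measurable[past (armStep Y W) k] fun ω =>
      discount q (armStep Y W · ω) k * ‖R (x + walk (armStep Y W · ω) k)‖ₑ := fun k => by
    have h1 : Measurable fun y => ‖R (x + y)‖ₑ := by fun_prop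
    exact (measurable_past_discount le_rfl).mul (h1.comp (measurable_past_walk le_rfl))
  have hle := past_le hX.measurable
  have hcongr : ∀ᵐ ω ∂P, ∑' s : ℕ, ENNReal.ofReal (|R (x + S Y W s ω)| *
      ∫ r in (T W s ω : ℝ)..(T W (s + 1) ω : ℝ), Real.exp (-q * r)) =
      ∑' s : ℕ, discount q (armStep Y W · ω) s * ‖R (x + walk (armStep Y W · ω) s)‖ₑ *
        g (armStep Y W s ω) := by
    filter_upwards [h.ae_walk_eq] with ω hω
    refine tsum_congr fun s => ?_
    rw [integral_exp_neg_mul hq.ne', hω, ← clock_armStep (Y := Y), ← clock_armStep (Y := Y),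
      clock_succ, discount, hg, Real.enorm_eq_ofReal_abs,
      ← ENNReal.ofReal_mul (Real.exp_nonneg _), ← ENNReal.ofReal_mul (by positivity)]
    congr 1
    push_cast
    rw [mul_add, Real.exp_add]
    ring
  have hc : ∫⁻ ω, g (armStep Y W 0 ω) ∂P ≠ 0 := by
    intro h0
    rw [lintegral_eq_zero_iff (f := fun ω => g (armStep Y W 0 ω))
      (hgm.comp (hX.measurable 0))] at h0
    have : ∀ᵐ ω ∂P, False := by
      filter_upwards [h0, hX.pos] with ω h1 h2
      have h3 : (0 : ℝ) < (armStep Y W 0 ω).2 := h2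
      have h4 : Real.exp (-q * ((armStep Y W 0 ω).2 : ℝ)) < 1 :=
        Real.exp_lt_one_iff.2 (by nlinarith)
      have h5 := ENNReal.ofReal_eq_zero.1 h1
      exact absurd h5 (div_pos (by linarith) hq).not_ge
    exact IsProbabilityMeasure.ne_zero P (by simpa using this)
  rw [RewardIntegrable, lintegral_congr_ae hcongr, lintegral_tsum
    (f := fun k ω => discount q (armStep Y W · ω) k * ‖R (x + walk (armStep Y W · ω) k)‖ₑ *
      g (armStep Y W k ω)) fun k => (((hterm k).mono (hle k) le_rfl).mul (hgm.comp (hX.measurable k))).aemeasurable] at hint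
  have hfac : ∀ k, ∫⁻ ω, discount q (armStep Y W · ω) k * ‖R (x + walk (armStep Y W · ω) k)‖ₑ *
      g (armStep Y W k ω) ∂P = occ (armStep Y W) P q univ k (fun y => ‖R (x + y)‖ₑ) *
        ∫⁻ ω, g (armStep Y W 0 ω) ∂P := by
    intro k
    rw [lintegral_mul_eq_lintegral_mul_lintegral_of_independent_measurableSpace (hle k)
      (g := fun ω => g (armStep Y W k ω)) (hX.measurable k).comap_le (hX.indep_step k) (hterm k)
      (hgm.comp (comap_measurable _))]
    congr 1
    · simp [occ]
    · exact ((hX.identDistrib k).comp hgm).lintegral_eq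
  simp only [hfac] at hint
  rw [ENNReal.tsum_mul_right] at hint
  exact fun htop => hint.ne (by rw [htop, ENNReal.top_mul hc])

/-- The discounted rewards up to any stopping time, compared with the average reward up to the
first weak descending ladder epoch. -/
lemma IsLevyArm.tsum_occIntegral_reward_le (h : IsLevyArm Y W P) (hq : 0 < q) (hR : Monotone R)
    (hint : RewardIntegrable Y W P q R x) {D : ℕ → Set Ω}
    (hD : ∀ n, MeasurableSet[past (armStep Y W) n] (D n)) (hanti : ∀ n, D (n + 1) ≤ᵐ[P] D n) :
    ∑' k, occIntegral (armStep Y W) P q (D k) k (fun y => R (x + y)) ≤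
      (∫ y, R (x + y) ∂(mu Y W P q)) *
        ∑' k, occIntegral (armStep Y W) P q (D k) k (fun _ => (1 : ℝ)) := by
  have hX := h.isIIDSteps
  set Γ := ∫ y, R (x + y) ∂(mu Y W P q) with hΓ
  have hRm := hR.measurable
  have hfm : Measurable fun y => R (x + y) := by fun_prop
  have huniv := h.tsum_occ_ne_top hq hR hint
  have hsub : ∀ (D : ℕ → Set Ω) (g g' : ℝ → ℝ≥0∞), g ≤ g' →
      ∑' k, occ (armStep Y W) P q univ k g' ≠ ∞ → ∑' k, occ (armStep Y W) P q (D k) k g ≠ ∞ :=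
    fun D g g' hg hfin => ((ENNReal.tsum_le_tsum fun k => (occ_mono _ _ hg).trans
      (occ_mono_set (subset_univ (D k)).eventuallyLE k g')).trans_lt
        (lt_top_iff_ne_top.2 hfin)).ne
  have hh : Monotone fun y => R (x + y) - Γ := fun a b hab => by
    have := hR (add_le_add_right hab x)
    dsimp only
    linarith
  have hhm := hh.measurable
  have hhfin : ∑' k, occ (armStep Y W) P q univ k (fun y => ‖R (x + y) - Γ‖ₑ) ≠ ∞ := by
    have h1 : ∑' k, occ (armStep Y W) P q univ k
        ((fun y => ‖R (x + y)‖ₑ) + fun _ => ‖Γ‖ₑ) ≠ ∞ := by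
      simp only [occ_add hX.measurable _ _ hfm.enorm]
      rw [ENNReal.tsum_add]
      exact ENNReal.add_ne_top.2 ⟨huniv,
        hX.tsum_occ_const_ne_top hq (fun _ => univ) (by simp)⟩
    exact hsub (fun _ => univ) _ _ (fun y => enorm_sub_le) h1
  have hlin : ∀ D : ℕ → Set Ω,
      ∑' k, occIntegral (armStep Y W) P q (D k) k (fun y => R (x + y) - Γ) =
        ∑' k, occIntegral (armStep Y W) P q (D k) k (fun y => R (x + y)) -
          Γ * ∑' k, occIntegral (armStep Y W) P q (D k) k (fun _ => (1 : ℝ)) := by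
    intro D
    have i1 := hsub D _ _ le_rfl huniv
    have i2 := hX.tsum_occ_const_ne_top (c := ‖(1 : ℝ)‖ₑ) hq D (by simp)
    have s1 := (summable_norm_occIntegral hX.measurable hfm.stronglyMeasurable i1).of_norm
    have s2 := (summable_norm_occIntegral (f := fun _ => (1 : ℝ)) hX.measurable
      stronglyMeasurable_const i2).of_norm
    rw [← tsum_mul_left, ← s1.tsum_sub (s2.mul_left Γ)]
    refine tsum_congr fun k => ?_
    have j1 := integrableOn_occIntegrand hX.measurable hfm.stronglyMeasurable
      (ENNReal.ne_top_of_tsum_ne_top i1 k)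
    have j2 := integrableOn_occIntegrand (f := fun _ => (1 : ℝ)) hX.measurable
      stronglyMeasurable_const (ENNReal.ne_top_of_tsum_ne_top i2 k)
    rw [occIntegral, occIntegral, occIntegral, ← integral_const_mul,
      ← integral_sub j1 (j2.const_mul Γ)]
    refine integral_congr_ae (ae_of_all _ fun ω => ?_)
    simp only [smul_eq_mul]
    ring
  -- `Γ` is the reward ratio at `Nhat`, so the centred reward balances exactly up to that epoch.
  have hbal : ∑' k, occIntegral (armStep Y W) P q (stay (armStep Y W) k) k
      (fun y => R (x + y) - Γ) = 0 := by
    have i1 := hsub (stay (armStep Y W)) _ _ le_rfl huniv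
    have h1 := h.integral_mu_eq_discountedRatio hq hfm
      ((h.integrable_mu_iff hq hfm.stronglyMeasurable).2 i1)
    rw [h.discountedRatio_eq hq hfm h.measurableSet_stay h.stay_ae_eq i1, ← hΓ, eq_div_iff
      (hX.tsum_occIntegral_one_pos hq stay_zero.eventuallyEq).ne'] at h1
    rw [hlin, h1, sub_self]
  have hpos : ∀ D : ℕ → Set Ω, ∑' k, occ (armStep Y W) P q (D k) k
      (fun y => ENNReal.ofReal (R (x + y) - Γ)) ≠ ∞ := fun D =>
    hsub D _ _ (fun y => Real.ofReal_le_enorm _) hhfin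
  have hneg : ∀ D : ℕ → Set Ω, ∑' k, occ (armStep Y W) P q (D k) k
      (fun y => ENNReal.ofReal (-(R (x + y) - Γ))) ≠ ∞ := fun D =>
    hsub D _ _ (fun y => (Real.ofReal_le_enorm _).trans_eq (enorm_neg _)) hhfin
  rw [tsum_occIntegral_eq_sub hX.measurable hhm (hsub _ _ _ le_rfl hhfin), sub_eq_zero,
    ENNReal.toReal_eq_toReal_iff' (hpos _) (hneg _)] at hbal
  have hmain := hX.tsum_occ_le hq hh (hpos fun _ => univ) (hneg fun _ => univ) hbal.le hD hanti
  have hle : ∑' k, occIntegral (armStep Y W) P q (D k) k (fun y => R (x + y) - Γ) ≤ 0 := by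
    rw [tsum_occIntegral_eq_sub hX.measurable hhm (hsub _ _ _ le_rfl hhfin), sub_nonpos]
    exact ENNReal.toReal_mono (hneg D) hmain
  rw [hlin] at hle
  linarith

lemma IsLevyArm.integrable_reward (h : IsLevyArm Y W P) (hq : 0 < q) (hR : Monotone R)
    (hint : RewardIntegrable Y W P q R x) : Integrable (fun y => R (x + y)) (mu Y W P q) := by
  have hRm := hR.measurable
  have hfm : Measurable fun y => R (x + y) := by fun_prop
  refine (h.integrable_mu_iff hq hfm.stronglyMeasurable).2 ?_
  exact ((ENNReal.tsum_le_tsum fun k => occ_mono_set (subset_univ _).eventuallyLE k _).trans_lt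
    (lt_top_iff_ne_top.2 (h.tsum_occ_ne_top hq hR hint))).ne

lemma IsLevyArm.discountedRatio_le (h : IsLevyArm Y W P) (hq : 0 < q) (hR : Monotone R)
    (hint : RewardIntegrable Y W P q R x) {τ : Ω → WithTop ℕ}
    (hτ : IsStoppingTime (armFiltration Y W P) τ) (hpos : ∀ ω, 0 < τ ω) :
    discountedRatio Y W P q (fun y => R (x + y)) τ ≤ ∫ y, R (x + y) ∂(mu Y W P q) := by
  have hRm := hR.measurable
  have hfm : Measurable fun y => R (x + y) := by fun_prop
  choose D hD hDτ using h.exists_past_ae_eq hτ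
  have hanti : ∀ n, D (n + 1) ≤ᵐ[P] D n := fun n => by
    refine (hDτ (n + 1)).le.trans (EventuallyLE.trans (Eventually.of_forall fun ω hω => ?_)
      (hDτ n).symm.le)
    exact lt_trans (by exact_mod_cast n.lt_succ_self) hω
  have hD0 : D 0 =ᵐ[P] univ := (hDτ 0).trans (by
    refine Eventually.of_forall fun ω => propext ⟨fun _ => trivial, fun _ => ?_⟩
    exact hpos ω)
  have hfin : ∑' k, occ (armStep Y W) P q (D k) k (fun y => ‖R (x + y)‖ₑ) ≠ ∞ :=
    ((ENNReal.tsum_le_tsum fun k => occ_mono_set (subset_univ _).eventuallyLE k _).trans_lt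
      (lt_top_iff_ne_top.2 (h.tsum_occ_ne_top hq hR hint))).ne
  rw [h.discountedRatio_eq hq hfm (fun k => past_le h.measurable_armStep k _ (hD k)) hDτ hfin,
    div_le_iff₀ (h.isIIDSteps.tsum_occIntegral_one_pos hq hD0)]
  exact h.tsum_occIntegral_reward_le hq hR hint hD hanti

/-- The integral bounds every admissible ratio, and it is the ratio of `Nhat`, itself an admissible
stopping time. -/
theorem IsLevyArm.gittinsIndex_eq (h : IsLevyArm Y W P) (hq : 0 < q) (hR : Monotone R)
    (hint : RewardIntegrable Y W P q R x) :
    gittinsIndex Y W P q R x = ((∫ y, R (x + y) ∂(mu Y W P q) : ℝ) : EReal) := by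
  have hRm := hR.measurable
  have hfm : Measurable fun y => R (x + y) := by fun_prop
  refine le_antisymm (iSup_le fun τ => iSup₂_le fun hτ hpos => ?_) ?_
  · exact EReal.coe_le_coe_iff.2 (h.discountedRatio_le hq hR hint hτ hpos)
  · rw [h.integral_mu_eq_discountedRatio hq hfm (h.integrable_reward hq hR hint)]
    exact le_iSup_of_le (Nhat Y W) (le_iSup₂_of_le isStoppingTime_Nhat
      (fun ω => hittingAfter_one_pos ω) le_rfl)

end Gittins

end

end LevyBandit

end

theorem proposition3p2 {Ω : Type*} [MeasurableSpace Ω] (P : Measure Ω) [IsProbabilityMeasure P]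
    (Y : ℝ≥0 → Ω → ℝ) (W : ℕ → Ω → ℝ≥0) (hArm : LevyBandit.IsLevyArm Y W P)
    (q : ℝ) (hq : 0 < q) :
    -- `μ` is a probability measure on `[0, ∞)`
    IsProbabilityMeasure (LevyBandit.mu Y W P q) ∧
    LevyBandit.mu Y W P q (Iio 0) = 0 ∧
    -- integrals against `μ` are normalized discounted sums up to the first weak descending epoch
    (∀ f : ℝ → ℝ, Measurable f → IntegrableOn f (Ici 0) (LevyBandit.mu Y W P q) →
      ∫ y in Ici 0, f y ∂(LevyBandit.mu Y W P q) =
        LevyBandit.discountedRatio Y W P q f (LevyBandit.Nhat Y W)) ∧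
    -- the Gittins index is `x ↦ ∫ R(x + y) μ(dy)`
    (∀ R : ℝ → ℝ, StrictMono R → ∀ x : ℝ, LevyBandit.RewardIntegrable Y W P q R x →
      IntegrableOn (fun y => R (x + y)) (Ici 0) (LevyBandit.mu Y W P q) ∧
      LevyBandit.gittinsIndex Y W P q R x =
        ((∫ y in Ici 0, R (x + y) ∂(LevyBandit.mu Y W P q) : ℝ) : EReal)) ∧
    -- the Fourier transform of `μ`
    (∀ θ : ℝ,
      (1 - LevyBandit.kappa Y W P q θ ≠ 0 ∧ 1 - LevyBandit.phihat Y W P q 0 ≠ 0 ∧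
        1 - LevyBandit.phi Y W P q θ ≠ 0) ∧
      ∫ y in Ici (0 : ℝ), Complex.exp (Complex.I * θ * y) ∂(LevyBandit.mu Y W P q) =
        (1 - LevyBandit.phihat Y W P q θ) / (1 - LevyBandit.kappa Y W P q θ) *
          ((1 - LevyBandit.kappa Y W P q 0) / (1 - LevyBandit.phihat Y W P q 0)) ∧
      (1 - LevyBandit.phihat Y W P q θ) / (1 - LevyBandit.kappa Y W P q θ) *
          ((1 - LevyBandit.kappa Y W P q 0) / (1 - LevyBandit.phihat Y W P q 0)) =
        (1 - LevyBandit.phi Y W P q 0) / (1 - LevyBandit.phi Y W P q θ)) := by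
  have hμ := hArm.isProbabilityMeasure_mu hq
  refine ⟨hμ, hArm.mu_Iio_zero, fun f hf hfi => ?_, fun R hR x hint => ?_, fun θ => ?_⟩
  · rw [IntegrableOn, hArm.restrict_mu] at hfi
    rw [hArm.restrict_mu, hArm.integral_mu_eq_discountedRatio hq hf hfi]
  · rw [IntegrableOn, hArm.restrict_mu]
    exact ⟨hArm.integrable_reward hq hR.monotone hint, hArm.gittinsIndex_eq hq hR.monotone hint⟩
  -- With `U = occTransform`, the factorizations give `U = (1 - φ̂) / (1 - κ) = 1 / (1 - φ)`, so
  -- both expressions equal `U(θ) / U(0)`. The factors `U(0)` and `1 - φ(q, θ)` are nonzero because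
  -- each occurs in a product equal to 1.
  · have hκ := hArm.one_sub_kappa_ne_zero (θ := θ) hq
    have hκ0 := hArm.one_sub_kappa_ne_zero (θ := 0) hq
    have h1 := hArm.one_sub_phi_mul (θ := θ) hq
    have h0 := hArm.one_sub_phi_mul (θ := 0) hq
    have hU0 := right_ne_zero_of_mul (h0 ▸ one_ne_zero)
    have hφ := left_ne_zero_of_mul (h1 ▸ one_ne_zero)
    refine ⟨⟨hκ, ?_, hφ⟩, ?_, ?_⟩
    · rw [hArm.one_sub_phihat hq]
      exact mul_ne_zero hκ0 hU0
    · rw [hArm.restrict_mu, hArm.integral_exp_mu_eq_div hq, hArm.one_sub_phihat hq,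
        hArm.one_sub_phihat hq]
      field_simp
    · rw [hArm.one_sub_phihat hq, hArm.one_sub_phihat hq]
      field_simp
      linear_combination h1 - h0
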